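/- **Theorem 5.** *Class $\mathbb M$ chains.* Let $M,j_0\ge 0$ be integers and $\mathcal N$ a finite set. A class $\mathbb M$ Markov chain is an ergodic continuous time Markov chain on $\mathcal N\cup\mathcal R$, $\mathcal R=\{(m,j):0\le m\le M,\ j\ge j_0\}$ ($m$ is the phase, $j$ the level), whose transition rates $q(\cdot,\cdot)$ satisfy: rates between states of $\mathcal N$ are arbitrary; transitions from $\mathcal N$ to $\mathcal R$ and from $\mathcal R$ to $\mathcal N$ enter, respectively leave, $\mathcal R$ only in level $j_0$; $q((m,j),(m,j+1))=\lambda_m$ for $j\ge j_0$ and $q((m,j),(m,j-1))=\mu_m$ for $j\ge j_0+1$; for $m<i$ and $\Delta\in\{-1,0,1\}$, $q((m,j),(i,j+\Delta))=\alpha_m\langle i-m;\Delta\rangle$ whenever $j\ge j_0$ and $j+\Delta\ge j_0$; there are no other transitions inside $\mathcal R$. Put $$\alpha_m=\sum_{i=m+1}^M\sum_{\Delta=-1}^1\alpha_m\langle i-m;\Delta\rangle,\qquad \phi_m(s)=\frac{s+\lambda_m+\mu_m-\sqrt{(s+\lambda_m+\mu_m)^2-4\lambda_m\mu_m}}{2\lambda_m},$$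 $$r_m=\frac{\lambda_m}{\mu_m}\phi_m(\alpha_m),\qquad \Omega_m=\frac{r_m}{\lambda_m(1-r_m\phi_m(\alpha_m))},$$ and abbreviate $\phi_m=\phi_m(\alpha_m)$. Let $\pi$ be the limiting probability distribution of the chain. *Statement.* Suppose that all $\lambda_m,\mu_m>0$ and $r_0=r_1=\cdots=r_{M-1}\ne r_M$ (so $M\ge1$). Then there are constants $\{c_{m,k}\}_{0\le k\le m\le M}$ such that for all $j\ge j_0$ (with $\binom{-1}{0}=1$) $$\pi_{(m,j)}=\sum_{k=0}^m c_{m,k}\binom{j-j_0-1+k}{k}r_0^{\,j-j_0}\qquad(0\le m\le M-1),$$ $$\pi_{(M,j)}=\sum_{k=0}^{M-1}c_{M,k}\binom{j-j_0-1+k}{k}r_0^{\,j-j_0}+c_{M,M}\,r_M^{\,j-j_0},$$ and these constants, together with the values $\pi_{(m,j_0)}$ $(0\le m\le M)$ and $\pi_x$ $(x\in\mathcal N)$, satisfy the following system of linear equations: * $c_{m,0}=\pi_{(m,j_0)}$ for $0\le m<M$; * for $1\le k<m<M$, $$c_{m,k}=\Omega_m r_0\sum_{u=k}^{m-1}\sum_{i=u}^{m-1}c_{i,u}\sum_{\Delta=-1}^1\frac{\alpha_i\langle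 m-i;\Delta\rangle\,\phi_m^{\Delta+1}}{(1-r_0\phi_m)^{u+1-k}}+\Omega_m\sum_{i=k-1}^{m-1}c_{i,k-1}\sum_{\Delta=-1}^1\alpha_i\langle m-i;\Delta\rangle r_0^{-\Delta}-\frac1{\lambda_m}\sum_{i=k}^{m-1}c_{i,k}\,\alpha_i\langle m-i;1\rangle;$$ * $c_{m,m}=c_{m-1,m-1}\,\Omega_m\sum_{\Delta=-1}^1\alpha_{m-1}\langle1;\Delta\rangle r_0^{-\Delta}$ for $1\le m<M$; * for $0\le k<M$, $$c_{M,k}=-\sum_{i=k}^{M-1}c_{i,k}\frac{\alpha_i\langle M-i;1\rangle}{\lambda_M}+\sum_{u=k}^{M-1}\sum_{i=u}^{M-1}c_{i,u}\Omega_M r_0\sum_{\Delta=-1}^1\alpha_i\langle M-i;\Delta\rangle\left[\frac1{(1-r_0)^{u+1-k}}-\frac1{r_M^{\Delta+1}\left(1-\frac{r_0}{r_M}\right)^{u+1-k}}\right];$$ * $c_{M,M}=\pi_{(M,j_0)}-c_{M,0}$; * the balance equations of the states $(m,j_0)$, $0\le m\le M$: $$\pi_{(m,j_0)}\Big(\lambda_m+\sum_{i=m+1}^M\sum_{\Delta=0}^1\alpha_m\langle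 i-m;\Delta\rangle+\sum_{x\in\mathcal N}q((m,j_0),x)\Big)=\mu_m\pi_{(m,j_0+1)}+\sum_{x\in\mathcal N}q(x,(m,j_0))\pi_x+\sum_{i=0}^{m-1}\sum_{\Delta=-1}^0\alpha_i\langle m-i;\Delta\rangle\pi_{(i,j_0-\Delta)},$$ in which $\pi_{(m,j_0+1)}$ stands for $\sum_{k=0}^m c_{m,k}r_0$ if $m<M$ and for $\sum_{k=0}^{M-1}c_{M,k}r_0+c_{M,M}r_M$ if $m=M$; * the balance equations of the states $x\in\mathcal N$ (with $q(x,x)=0$): $$\pi_x\Big(\sum_{m=0}^M q(x,(m,j_0))+\sum_{y\in\mathcal N}q(x,y)\Big)=\sum_{m=0}^M q((m,j_0),x)\pi_{(m,j_0)}+\sum_{y\in\mathcal N}q(y,x)\pi_y;$$ * the normalization constraint $$\sum_{x\in\mathcal N}\pi_x+\sum_{m=0}^{M-1}\Big(\frac{c_{m,0}}{1-r_0}+\sum_{k=1}^m\frac{c_{m,k}\,r_0}{(1-r_0)^{k+1}}\Big)+\frac{c_{M,0}}{1-r_0}+\sum_{k=1}^{M-1}\frac{c_{M,k}\,r_0}{(1-r_0)^{k+1}}+\frac{c_{M,M}}{1-r_M}=1.$$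 -/

import Mathlib

open Filter Topology

noncomputable section

/-- State space `𝒩 ∪ ℛ`: the finite nonrepeating portion `N`, and the repeating portion
`{(m, j) : 0 ≤ m ≤ M, j ≥ j₀}` of pairs (phase, level). -/
abbrev MState (N : Type*) (M j₀ : ℕ) : Type _ := N ⊕ (Fin (M + 1) × {j : ℕ // j₀ ≤ j})

/-- The state `(m, j)` of the repeating portion. -/
abbrev MState.rep {N : Type*} {M j₀ : ℕ} (m : Fin (M + 1)) (j : ℕ) (hj : j₀ ≤ j) :
    MState N M j₀ := Sum.inr (m, ⟨j, hj⟩)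

/-- The state `x` of the nonrepeating portion. -/
abbrev MState.non {N : Type*} {M j₀ : ℕ} (x : N) : MState N M j₀ := Sum.inl x

/-- `P t x y` is the transition function of a continuous time Markov chain on the countable state
space `S` whose transition rate from `x` to `y ≠ x` is `q x y` (with the convention `q x x = 0`):
`P` is a semigroup of stochastic matrices, whose derivative at `t = 0` is the generator with
off-diagonal entries `q x y` and diagonal entries minus the total outgoing rates. -/
structure IsTransitionFunction {S : Type*} (q : S → S → ℝ) (P : ℝ → S → S → ℝ) : Prop where
  nonneg : ∀ t, 0 ≤ t → ∀ x y, 0 ≤ P t x y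
  row_sum : ∀ t, 0 ≤ t → ∀ x, HasSum (fun y => P t x y) 1
  zero_self : ∀ x, P 0 x x = 1
  zero_of_ne : ∀ x y, x ≠ y → P 0 x y = 0
  chapman_kolmogorov : ∀ s t, 0 ≤ s → 0 ≤ t → ∀ x y,
    HasSum (fun z => P s x z * P t z y) (P (s + t) x y)
  rate_summable : ∀ x, Summable (fun y => q x y)
  deriv_of_ne : ∀ x y, x ≠ y →
    HasDerivWithinAt (fun t => P t x y) (q x y) (Set.Ici 0) 0
  deriv_self : ∀ x, HasDerivWithinAt (fun t => P t x x) (-∑' y, q x y) (Set.Ici 0) 0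

/-- `π` is the limiting probability distribution of the chain: a probability distribution to which
the law at time `t` converges as `t → ∞`, from every initial state. -/
structure IsLimitingDistribution {S : Type*} (P : ℝ → S → S → ℝ) (π : S → ℝ) : Prop where
  hasSum_one : HasSum π 1
  tendsto : ∀ x y, Tendsto (fun t => P t x y) atTop (𝓝 (π y))

/-- The chain is ergodic: it is irreducible, and it has a limiting probability distribution
(that is, it is positive recurrent). -/
structure IsErgodicChain {S : Type*} (P : ℝ → S → S → ℝ) : Prop where
  irreducible : ∀ x y, ∃ t, 0 ≤ t ∧ 0 < P t x y
  exists_limiting : ∃ π : S → ℝ, IsLimitingDistribution P π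

/-- The transition rates of a class `𝕄` Markov chain.  Here `q x y` is the transition rate from
`x` to `y`, and, in the repeating portion, `lam m = λ_m`, `mu m = μ_m` and
`alp m Δ₁ Δ₂ = α_m⟨Δ₁; Δ₂⟩`, the rate at which the phase increases from `m` to `m + Δ₁` while the
level changes by `Δ₂ ∈ {-1, 0, 1}`.  Only the values of `lam`, `mu`, `alp` at phases `≤ M` matter. -/
structure ClassM (N : Type*) (M j₀ : ℕ) where
  q : MState N M j₀ → MState N M j₀ → ℝ
  lam : ℕ → ℝ
  mu : ℕ → ℝ
  alp : ℕ → ℕ → ℤ → ℝ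
  q_nonneg : ∀ x y, 0 ≤ q x y
  q_self : ∀ x, q x x = 0
  -- from the nonrepeating portion one can enter the repeating portion only at level `j₀`
  q_non_rep : ∀ (x : N) (m : Fin (M + 1)) (j : ℕ) (hj : j₀ ≤ j), j₀ < j →
    q (MState.non x) (MState.rep m j hj) = 0
  -- from the repeating portion one can enter the nonrepeating portion only from level `j₀`
  q_rep_non : ∀ (x : N) (m : Fin (M + 1)) (j : ℕ) (hj : j₀ ≤ j), j₀ < j →
    q (MState.rep m j hj) (MState.non x) = 0
  -- transitions within a phase
  q_right : ∀ (m : Fin (M + 1)) (j : ℕ) (hj : j₀ ≤ j),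
    q (MState.rep m j hj) (MState.rep m (j + 1) (Nat.le_succ_of_le hj)) = lam m
  q_left : ∀ (m : Fin (M + 1)) (j : ℕ) (hj : j₀ ≤ j),
    q (MState.rep m (j + 1) (Nat.le_succ_of_le hj)) (MState.rep m j hj) = mu m
  -- transitions to a higher phase
  q_up_left : ∀ (m i : Fin (M + 1)), m < i → ∀ (j : ℕ) (hj : j₀ ≤ j),
    q (MState.rep m (j + 1) (Nat.le_succ_of_le hj)) (MState.rep i j hj)
      = alp m ((i : ℕ) - m) (-1)
  q_up_stay : ∀ (m i : Fin (M + 1)), m < i → ∀ (j : ℕ) (hj : j₀ ≤ j),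
    q (MState.rep m j hj) (MState.rep i j hj) = alp m ((i : ℕ) - m) 0
  q_up_right : ∀ (m i : Fin (M + 1)), m < i → ∀ (j : ℕ) (hj : j₀ ≤ j),
    q (MState.rep m j hj) (MState.rep i (j + 1) (Nat.le_succ_of_le hj))
      = alp m ((i : ℕ) - m) 1
  -- transitions are unidirectional in phase and skip-free in level
  q_unidirectional : ∀ (m i : Fin (M + 1)), i < m → ∀ (j l : ℕ) (hj : j₀ ≤ j) (hl : j₀ ≤ l),
    q (MState.rep m j hj) (MState.rep i l hl) = 0
  q_skip_free : ∀ (m i : Fin (M + 1)) (j l : ℕ) (hj : j₀ ≤ j) (hl : j₀ ≤ l),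
    (j + 1 < l ∨ l + 1 < j) → q (MState.rep m j hj) (MState.rep i l hl) = 0

namespace ClassM

variable {N : Type*} {M j₀ : ℕ}

/-- `α_m`, the total rate of leaving phase `m` from a state `(m, j)` with `j ≥ j₀ + 1`. -/
def alpha (C : ClassM N M j₀) (m : ℕ) : ℝ :=
  ∑ i ∈ Finset.Icc (m + 1) M, ∑ Δ ∈ Finset.Icc (-1 : ℤ) 1, C.alp m (i - m) Δ

/-- `ρ_m = λ_m / μ_m`. -/
def rho (C : ClassM N M j₀) (m : ℕ) : ℝ := C.lam m / C.mu m

/-- `φ_m(s)`, the Laplace transform of the M/M/1 busy period with rates `λ_m`, `μ_m`. -/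
def phi (C : ClassM N M j₀) (m : ℕ) (s : ℝ) : ℝ :=
  (s + C.lam m + C.mu m - √((s + C.lam m + C.mu m) ^ 2 - 4 * C.lam m * C.mu m)) / (2 * C.lam m)

/-- The base term `r_m`. -/
def r (C : ClassM N M j₀) (m : ℕ) : ℝ :=
  if 0 < C.mu m then C.rho m * C.phi m (C.alpha m) else C.lam m / (C.lam m + C.alpha m)

/-- `Ω_m`. -/
def Omega (C : ClassM N M j₀) (m : ℕ) : ℝ :=
  C.r m / (C.lam m * (1 - C.r m * C.phi m (C.alpha m)))

/-- The linear system, in the unknowns `c = (c_{m,k})_{0 ≤ k ≤ m ≤ M}`,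
`p m = π_{(m, j₀)}` (`0 ≤ m ≤ M`) and `w x = π_x` (`x ∈ 𝒩`), for a chain with
`r_0 = ⋯ = r_{M-1} ≠ r_M` and all `λ_m, μ_m > 0`. -/
structure LinearSystem [Fintype N] (C : ClassM N M j₀)
    (c : ℕ → ℕ → ℝ) (p : Fin (M + 1) → ℝ) (w : N → ℝ) : Prop where
  -- the coefficients of the phases `m < M`
  coeff_zero : ∀ m : Fin (M + 1), (m : ℕ) < M → c m 0 = p m
  coeff_mid : ∀ m k : ℕ, 1 ≤ k → k < m → m < M →
    c m k =
      C.Omega m * C.r 0 * (∑ u ∈ Finset.Ico k m, ∑ i ∈ Finset.Ico u m, c i u *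
        ∑ Δ ∈ Finset.Icc (-1 : ℤ) 1, C.alp i (m - i) Δ * C.phi m (C.alpha m) ^ (Δ + 1) /
          (1 - C.r 0 * C.phi m (C.alpha m)) ^ (u + 1 - k))
      + C.Omega m * (∑ i ∈ Finset.Ico (k - 1) m, c i (k - 1) *
        ∑ Δ ∈ Finset.Icc (-1 : ℤ) 1, C.alp i (m - i) Δ * C.r 0 ^ (-Δ))
      - 1 / C.lam m * ∑ i ∈ Finset.Ico k m, c i k * C.alp i (m - i) 1
  coeff_diag : ∀ m : ℕ, 1 ≤ m → m < M →
    c m m = c (m - 1) (m - 1) * C.Omega m *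
      ∑ Δ ∈ Finset.Icc (-1 : ℤ) 1, C.alp (m - 1) 1 Δ * C.r 0 ^ (-Δ)
  -- the coefficients of the phase `M`
  coeff_last : ∀ k : ℕ, k < M →
    c M k =
      - (∑ i ∈ Finset.Ico k M, c i k * (C.alp i (M - i) 1 / C.lam M))
      + ∑ u ∈ Finset.Ico k M, ∑ i ∈ Finset.Ico u M, c i u * C.Omega M * C.r 0 *
        ∑ Δ ∈ Finset.Icc (-1 : ℤ) 1, C.alp i (M - i) Δ *
          (1 / (1 - C.r 0) ^ (u + 1 - k)
            - 1 / (C.r M ^ (Δ + 1) * (1 - C.r 0 / C.r M) ^ (u + 1 - k)))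
  coeff_last_diag : c M M = p (Fin.last M) - c M 0
  -- the balance equations of the states `(m, j₀)`, with `π_{(m, j₀ + 1)}` written through `c`
  balance_rep : ∀ m : Fin (M + 1), (m : ℕ) < M →
    p m * (C.lam m
        + (∑ i ∈ Finset.Icc ((m : ℕ) + 1) M, ∑ Δ ∈ Finset.Icc (0 : ℤ) 1, C.alp m (i - m) Δ)
        + ∑ x : N, C.q (MState.rep m j₀ le_rfl) (MState.non x))
      = C.mu m * (∑ k ∈ Finset.range ((m : ℕ) + 1), c m k * C.r 0)
        + (∑ x : N, C.q (MState.non x) (MState.rep m j₀ le_rfl) * w x)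
        + ∑ i ∈ Finset.Iio m, (C.alp i ((m : ℕ) - i) 0 * p i
          + C.alp i ((m : ℕ) - i) (-1) * ∑ k ∈ Finset.range ((i : ℕ) + 1), c i k * C.r 0)
  balance_rep_last :
    p (Fin.last M) * (C.lam M
        + ∑ x : N, C.q (MState.rep (Fin.last M) j₀ le_rfl) (MState.non x))
      = C.mu M * ((∑ k ∈ Finset.range M, c M k * C.r 0) + c M M * C.r M)
        + (∑ x : N, C.q (MState.non x) (MState.rep (Fin.last M) j₀ le_rfl) * w x)
        + ∑ i ∈ Finset.Iio (Fin.last M), (C.alp i (M - i) 0 * p i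
          + C.alp i (M - i) (-1) * ∑ k ∈ Finset.range ((i : ℕ) + 1), c i k * C.r 0)
  -- the balance equations of the states `x ∈ 𝒩`
  balance_non : ∀ x : N,
    w x * ((∑ m : Fin (M + 1), C.q (MState.non x) (MState.rep m j₀ le_rfl))
        + ∑ y : N, C.q (MState.non x) (MState.non y))
      = (∑ m : Fin (M + 1), C.q (MState.rep m j₀ le_rfl) (MState.non x) * p m)
        + ∑ y : N, C.q (MState.non y) (MState.non x) * w y
  -- the normalization constraint, the sums over all levels being evaluated
  normalization :
    (∑ x : N, w x)
      + (∑ m ∈ Finset.range M, (c m 0 / (1 - C.r 0)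
          + ∑ k ∈ Finset.Icc 1 m, c m k * C.r 0 / (1 - C.r 0) ^ (k + 1)))
      + (c M 0 / (1 - C.r 0) + (∑ k ∈ Finset.Ico 1 M, c M k * C.r 0 / (1 - C.r 0) ^ (k + 1))
          + c M M / (1 - C.r M))
      = 1

end ClassM

end

/-! The limiting distribution is stationary and, the exit rates being bounded, satisfies the balance
equations (`IsLimitingDistribution.balance`). In phase m they form a second order linear recurrence
in the level, forced by the lower phases. Its characteristic polynomial has the roots r_m < 1 and
1/φ_m ≥ 1. Probabilities are summable, hence decay, which excludes the second root: a solution is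
determined by its value at level j₀ (`PhaseRoots.eq_of_recurrence`). It remains to exhibit a
decaying solution with the right initial value.

Seek it as r^n ∑ x_k R_k(n) with r = r_0 and R_k(n) = binom(n-1+k, k). By Pascal's rule, stepping
back in n acts on the coefficients as 1 - σ, where σ is the left shift (`binomSum_pred`), so the
recurrence becomes an equation between polynomials in σ (`binomSum_recurrence`).

For m < M the base r is itself a root, and the operator is (λ_m/r) σ ((1 - rφ_m) - σ). The factor σ
leaves x_0 free, to be set to π_{(m,j₀)}, and raises the degree by at most one per phase. For m = M,
α_M = 0, so ergodicity forces λ_M < μ_M (`lam_lt_mu`) and φ_M = 1. The operator is then -(λ_M/r) ((1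
- r) - σ) ((1 - r/r_M) - σ), invertible on finitely supported sequences since r ≠ 1 and r ≠ r_M; a
multiple of r_M^n adjusts the initial value. Partial fractions in σ give the stated coefficients
(`sameBase_identity`, `newBase_identity`). The other equations are balance at the boundary and total
mass one. -/

/-! ### Stationarity and balance for a general continuous time chain -/

section TransitionFunction

variable {S : Type*} {q : S → S → ℝ} {P : ℝ → S → S → ℝ} {π : S → ℝ}

namespace IsTransitionFunction

lemma le_one (hP : IsTransitionFunction q P) {t : ℝ} (ht : 0 ≤ t) (x y : S) : P t x y ≤ 1 :=
  le_hasSum (hP.row_sum t ht x) y (fun z _ => hP.nonneg t ht x z)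

lemma add_le_one (hP : IsTransitionFunction q P) {t : ℝ} (ht : 0 ≤ t) {x y : S} (h : x ≠ y) :
    P t x x + P t x y ≤ 1 := by
  classical
  have := sum_le_hasSum {x, y} (fun z _ => hP.nonneg t ht x z) (hP.row_sum t ht x)
  rwa [Finset.sum_pair h] at this

lemma pow_le (hP : IsTransitionFunction q P) {t : ℝ} (ht : 0 ≤ t) (x : S) (n : ℕ) :
    P t x x ^ n ≤ P (n * t) x x := by
  induction n with
  | zero => simp [hP.zero_self]
  | succ n ih =>
    have hn : (0 : ℝ) ≤ n * t := by positivity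
    have h1 := le_hasSum (hP.chapman_kolmogorov (n * t) t hn ht x x) x
      (fun z _ => mul_nonneg (hP.nonneg _ hn x z) (hP.nonneg t ht z x))
    have h2 : ((n + 1 : ℕ) : ℝ) * t = n * t + t := by push_cast; ring
    rw [h2, pow_succ]
    exact (mul_le_mul_of_nonneg_right ih (hP.nonneg t ht x x)).trans h1

/-- Cut [0, t] into n equal steps: `pow_le` and Bernoulli's inequality bound the left side by n (1 -
P_{t/n}(x,x)), which tends to t times the exit rate. -/
lemma one_sub_le (hP : IsTransitionFunction q P) {t : ℝ} (ht : 0 ≤ t) (x : S) :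
    1 - P t x x ≤ t * ∑' y, q x y := by
  rcases ht.eq_or_lt with rfl | ht'
  · simp [hP.zero_self]
  have hd := (hasDerivWithinAt_iff_tendsto_slope' (by simp)).1
    (hP.deriv_self x).Ioi_of_Ici
  have hseq : Tendsto (fun n : ℕ => t / ((n : ℝ) + 1)) atTop (𝓝[>] 0) := by
    refine tendsto_nhdsWithin_iff.2 ⟨?_, Eventually.of_forall fun n => ?_⟩
    · have := (tendsto_one_div_add_atTop_nhds_zero_nat (𝕜 := ℝ)).const_mul t
      simpa [mul_one_div, div_eq_mul_inv] using this
    · exact Set.mem_Ioi.2 (by positivity)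
  have h1 := (hd.comp hseq).const_mul t
  have h2 : t * -∑' y, q x y ≤ P t x x - 1 := by
    refine le_of_tendsto h1 (Eventually.of_forall fun n => ?_)
    have hn : (0 : ℝ) < (n : ℝ) + 1 := by positivity
    have hpow := hP.pow_le (t := t / ((n : ℝ) + 1)) (by positivity) x (n + 1)
    have hb := one_add_mul_le_pow (a := P (t / ((n : ℝ) + 1)) x x - 1)
      (by linarith [hP.nonneg (t / ((n : ℝ) + 1)) (by positivity) x x]) (n + 1)
    have he : ((n + 1 : ℕ) : ℝ) * (t / ((n : ℝ) + 1)) = t := by push_cast; field_simp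
    rw [he] at hpow
    rw [add_sub_cancel] at hb
    simp only [Function.comp, slope_def_field, hP.zero_self, sub_zero]
    have hs : t * ((P (t / ((n : ℝ) + 1)) x x - 1) / (t / ((n : ℝ) + 1)))
        = ((n + 1 : ℕ) : ℝ) * (P (t / ((n : ℝ) + 1)) x x - 1) := by
      push_cast; field_simp
    rw [hs]; linarith
  linarith

end IsTransitionFunction

namespace IsLimitingDistribution

lemma nonneg (hP : IsTransitionFunction q P) (hπ : IsLimitingDistribution P π) (y : S) :
    0 ≤ π y :=
  ge_of_tendsto (hπ.tendsto y y)
    ((eventually_ge_atTop 0).mono fun t ht => hP.nonneg t ht y y)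

lemma sum_mul_le (hP : IsTransitionFunction q P) (hπ : IsLimitingDistribution P π) {t : ℝ}
    (ht : 0 ≤ t) (y : S) (F : Finset S) : ∑ z ∈ F, π z * P t z y ≤ π y := by
  have h1 : Tendsto (fun s => ∑ z ∈ F, P s y z * P t z y) atTop (𝓝 (∑ z ∈ F, π z * P t z y)) :=
    tendsto_finsetSum _ fun z _ => (hπ.tendsto y z).mul_const _
  have h2 : Tendsto (fun s => P (s + t) y y) atTop (𝓝 (π y)) :=
    (hπ.tendsto y y).comp (tendsto_atTop_add_const_right _ t tendsto_id)
  refine le_of_tendsto_of_tendsto h1 h2 ((eventually_ge_atTop 0).mono fun s hs => ?_)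
  exact sum_le_hasSum F (fun z _ => mul_nonneg (hP.nonneg s hs y z) (hP.nonneg t ht z y))
    (hP.chapman_kolmogorov s t hs ht y y)

/-- The converse of `sum_mul_le` up to the mass outside F: there P t z y is replaced by 1. Only
finite sums pass to the limit in s, so no interchange is needed. -/
lemma le_sum_mul_add (hP : IsTransitionFunction q P) (hπ : IsLimitingDistribution P π) {t : ℝ}
    (ht : 0 ≤ t) (y : S) (F : Finset S) :
    π y ≤ ∑ z ∈ F, π z * P t z y + (1 - ∑ z ∈ F, π z) := by
  have h1 : Tendsto (fun s => ∑ z ∈ F, P s y z * P t z y + (1 - ∑ z ∈ F, P s y z)) atTop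
      (𝓝 (∑ z ∈ F, π z * P t z y + (1 - ∑ z ∈ F, π z))) :=
    (tendsto_finsetSum _ fun z _ => (hπ.tendsto y z).mul_const _).add
      (tendsto_const_nhds.sub (tendsto_finsetSum _ fun z _ => hπ.tendsto y z))
  have h2 : Tendsto (fun s => P (s + t) y y) atTop (𝓝 (π y)) :=
    (hπ.tendsto y y).comp (tendsto_atTop_add_const_right _ t tendsto_id)
  refine le_of_tendsto_of_tendsto h2 h1 ((eventually_ge_atTop 0).mono fun s hs => ?_)
  have hd := (hP.row_sum s hs y).sub (hP.chapman_kolmogorov s t hs ht y y)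
  have := sum_le_hasSum F (fun z _ => by
    have := mul_le_mul_of_nonneg_left (hP.le_one ht z y) (hP.nonneg s hs y z)
    linarith) hd
  rw [Finset.sum_sub_distrib] at this
  show P (s + t) y y ≤ _
  linarith

/-- The limiting distribution is stationary. -/
lemma stationary (hP : IsTransitionFunction q P) (hπ : IsLimitingDistribution P π) {t : ℝ}
    (ht : 0 ≤ t) (y : S) : HasSum (fun z => π z * P t z y) (π y) := by
  have hn : ∀ z, 0 ≤ π z * P t z y := fun z => mul_nonneg (hπ.nonneg hP z) (hP.nonneg t ht z y)
  have hs : Summable (fun z => π z * P t z y) :=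
    summable_of_sum_le hn (hπ.sum_mul_le hP ht y)
  have h1 : ∑' z, π z * P t z y ≤ π y := hs.tsum_le_of_sum_le (hπ.sum_mul_le hP ht y)
  have h2 : π y ≤ ∑' z, π z * P t z y + (1 - 1) :=
    ge_of_tendsto (Tendsto.add (α := Finset S) hs.hasSum
      (Tendsto.sub tendsto_const_nhds hπ.hasSum_one)) (Eventually.of_forall fun F => hπ.le_sum_mul_add hP ht y F)
  rw [show π y = ∑' z, π z * P t z y by linarith]
  exact hs.hasSum

/-- Some state has positive mass, and stationarity carries it along irreducibility to every other
state. -/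
lemma pos (hP : IsTransitionFunction q P) (herg : IsErgodicChain P)
    (hπ : IsLimitingDistribution P π) (y : S) : 0 < π y := by
  obtain ⟨z, hz⟩ : ∃ z, 0 < π z := by
    by_contra! h
    have h0 : π = fun _ => 0 := funext fun z => le_antisymm (h z) (hπ.nonneg hP z)
    have := hπ.hasSum_one
    rw [h0] at this
    exact zero_ne_one (hasSum_zero.unique this)
  obtain ⟨t, ht, hpos⟩ := herg.irreducible z y
  exact (mul_pos hz hpos).trans_le (le_hasSum (hπ.stationary hP ht y) z
    fun w _ => mul_nonneg (hπ.nonneg hP w) (hP.nonneg t ht w y))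

/-- The balance equations of a chain with bounded exit rates. -/
lemma balance (hP : IsTransitionFunction q P) (hπ : IsLimitingDistribution P π)
    (hq0 : ∀ x y, 0 ≤ q x y) (hself : ∀ x, q x x = 0) {K : ℝ} (hK : ∀ x, ∑' y, q x y ≤ K) (y : S) :
    ∑' z, π z * q z y = π y * ∑' z, q y z := by
  classical
  -- Column y of the generator; the plan is to differentiate π P_t = π at t = 0.
  set Q : S → ℝ := fun z => if z = y then -∑' w, q y w else q z y with hQ
  have hlim : Tendsto (fun t => ∑' z, π z * slope (fun t => P t z y) 0 t) (𝓝[>] 0)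
      (𝓝 (∑' z, π z * Q z)) := by
    -- The difference quotients are bounded by K uniformly in z: for z ≠ y, P_t(z,y) ≤ 1 - P_t(z,z),
    -- and by `one_sub_le` this is at most tK.
    refine tendsto_tsum_of_dominated_convergence (bound := fun z => π z * K)
      (hπ.hasSum_one.summable.mul_right K) (fun z => Tendsto.const_mul _ ?_) ?_
    · refine (hasDerivWithinAt_iff_tendsto_slope' (by simp)).1
        (HasDerivWithinAt.Ioi_of_Ici ?_)
      by_cases h : z = y
      · subst h; simpa [hQ] using hP.deriv_self z
      · simpa [hQ, h] using hP.deriv_of_ne z y h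
    · filter_upwards [self_mem_nhdsWithin] with t ht z
      have ht' : (0 : ℝ) < t := ht
      rw [norm_mul, Real.norm_of_nonneg (hπ.nonneg hP z)]
      refine mul_le_mul_of_nonneg_left ?_ (hπ.nonneg hP z)
      have h1 := (hP.one_sub_le ht'.le z).trans (mul_le_mul_of_nonneg_left (hK z) ht'.le)
      rw [slope_def_field, sub_zero, Real.norm_eq_abs, abs_div, abs_of_pos ht', div_le_iff₀ ht',
        mul_comm K]
      by_cases h : z = y
      · subst h
        rw [hP.zero_self, abs_sub_comm, abs_of_nonneg (by linarith [hP.le_one ht'.le z z])]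
        exact h1
      · rw [hP.zero_of_ne z y h, sub_zero, abs_of_nonneg (hP.nonneg t ht'.le z y)]
        linarith [hP.add_le_one ht'.le h]
  have hzero : ∀ᶠ t in 𝓝[>] (0 : ℝ), ∑' z, π z * slope (fun t => P t z y) 0 t = 0 := by
    filter_upwards [self_mem_nhdsWithin] with t ht
    have ht' : (0 : ℝ) < t := ht
    have h := ((hπ.stationary hP ht'.le y).sub (hπ.stationary hP le_rfl y)).div_const t
    rw [sub_self, zero_div] at h
    refine Eq.trans ?_ h.tsum_eq
    refine tsum_congr fun z => ?_
    rw [slope_def_field, sub_zero]; ring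
  have h0 : ∑' z, π z * Q z = 0 :=
    tendsto_nhds_unique hlim (tendsto_const_nhds.congr' (hzero.mono fun t h => h.symm))
  have hsum : Summable (fun z => π z * q z y) :=
    Summable.of_nonneg_of_le (fun z => mul_nonneg (hπ.nonneg hP z) (hq0 z y))
      (fun z => mul_le_mul_of_nonneg_left
        (((hP.rate_summable z).le_tsum y fun w _ => hq0 z w).trans (hK z)) (hπ.nonneg hP z))
      (hπ.hasSum_one.summable.mul_right K)
  have h2 : HasSum (fun z => π z * Q z) (∑' z, π z * q z y + π y * -∑' w, q y w) := by
    refine (hsum.hasSum.add (hasSum_ite_eq y (π y * -∑' w, q y w))).congr_fun ?_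
    intro z
    by_cases h : z = y
    · subst h; simp [hQ, hself]
    · simp [hQ, h]
  rw [h2.tsum_eq] at h0
  linarith

end IsLimitingDistribution

end TransitionFunction

/-! ### Binomial times geometric sequences and second order recurrences -/

noncomputable section Sequences

/-- The binomial coefficient `binom (n - 1 + k) k`, with `binom (-1) 0 = 1`. -/
def risingChoose (k n : ℕ) : ℝ := (Nat.choose (n + k - 1) k : ℝ)

lemma risingChoose_zero (n : ℕ) : risingChoose 0 n = 1 := by simp [risingChoose]

lemma risingChoose_succ_zero (k : ℕ) : risingChoose (k + 1) 0 = 0 := by simp [risingChoose]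

lemma risingChoose_succ_sub (k n : ℕ) :
    risingChoose (k + 1) (n + 1) - risingChoose (k + 1) n = risingChoose k (n + 1) := by
  have h1 : n + 1 + (k + 1) - 1 = n + k + 1 := by omega
  have h2 : n + (k + 1) - 1 = n + k := by omega
  have h3 : n + 1 + k - 1 = n + k := by omega
  simp only [risingChoose, h1, h2, h3, Nat.choose_succ_succ]
  push_cast; ring

lemma hasSum_risingChoose {r : ℝ} (h0 : 0 ≤ r) (h1 : r < 1) (k : ℕ) :
    HasSum (fun n => risingChoose (k + 1) n * r ^ n) (r / (1 - r) ^ (k + 2)) := by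
  have h := (hasSum_choose_mul_geometric_of_norm_lt_one (k + 1)
    (by rwa [Real.norm_of_nonneg h0] : ‖r‖ < 1)).mul_left r
  rw [← hasSum_nat_add_iff' 1]
  simp only [Finset.range_one, Finset.sum_singleton, risingChoose_succ_zero, zero_mul, sub_zero]
  rw [mul_one_div] at h
  refine h.congr_fun fun n => ?_
  have h3 : n + 1 + (k + 1) - 1 = n + (k + 1) := by omega
  simp only [risingChoose, h3]
  ring

/-- The combination of the first `K` functions `risingChoose k` with coefficients `d`. -/
def binomSum (K : ℕ) (d : ℕ → ℝ) (n : ℕ) : ℝ := ∑ k ∈ Finset.range K, d k * risingChoose k n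

/-- Pascal's rule R_k(n) = R_k(n+1) - R_{k-1}(n+1) for k ≥ 1, summed by parts. The vanishing of d
from K on removes the boundary term at the top. -/
lemma binomSum_pred {K : ℕ} {d : ℕ → ℝ} (hd : ∀ k, K ≤ k → d k = 0) (n : ℕ) :
    binomSum K d n = binomSum K (fun k => d k - d (k + 1)) (n + 1) := by
  have key : ∑ k ∈ Finset.range K, d k * (risingChoose k (n + 1) - risingChoose k n)
      = ∑ k ∈ Finset.range K, d (k + 1) * risingChoose k (n + 1) := by
    cases K with
    | zero => simp
    | succ K =>
      rw [Finset.sum_range_succ', Finset.sum_range_succ, hd (K + 1) le_rfl]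
      simp [risingChoose_zero, risingChoose_succ_sub]
  simp only [mul_sub, Finset.sum_sub_distrib] at key
  simp only [binomSum, sub_mul, Finset.sum_sub_distrib]
  linarith

lemma binomSum_pred_pred {K : ℕ} {d : ℕ → ℝ} (hd : ∀ k, K ≤ k → d k = 0) (n : ℕ) :
    binomSum K d n = binomSum K (fun k => d k - 2 * d (k + 1) + d (k + 2)) (n + 2) := by
  rw [binomSum_pred hd, binomSum_pred (fun k hk => by
    rw [hd k hk, hd (k + 1) (by omega), sub_zero])]
  congr 1; funext k; ring

lemma hasSum_binomSum {r : ℝ} (h0 : 0 ≤ r) (h1 : r < 1) (K : ℕ) (d : ℕ → ℝ) :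
    HasSum (fun n => binomSum (K + 1) d n * r ^ n)
      (d 0 / (1 - r) + ∑ k ∈ Finset.Icc 1 K, d k * r / (1 - r) ^ (k + 1)) := by
  have hs : HasSum (fun n => ∑ k ∈ Finset.Icc 1 K, d k * (risingChoose k n * r ^ n))
      (∑ k ∈ Finset.Icc 1 K, d k * r / (1 - r) ^ (k + 1)) := by
    refine hasSum_sum fun k hk => ?_
    obtain ⟨k, rfl⟩ : ∃ l, k = l + 1 := ⟨k - 1, by have := (Finset.mem_Icc.1 hk).1; omega⟩
    rw [mul_div_assoc]
    exact (hasSum_risingChoose h0 h1 k).mul_left _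
  have hg := (hasSum_geometric_of_lt_one h0 h1).mul_left (d 0)
  rw [← div_eq_mul_inv] at hg
  refine (hg.add hs).congr_fun fun n => ?_
  have hI : Finset.range (K + 1) = insert 0 (Finset.Icc 1 K) := by
    ext k; simp only [Finset.mem_range, Finset.mem_insert, Finset.mem_Icc]; omega
  rw [binomSum, hI, Finset.sum_insert (by simp), risingChoose_zero, add_mul, Finset.sum_mul]
  simp only [mul_one, mul_assoc]

lemma tendsto_binomSum {r : ℝ} (h0 : 0 ≤ r) (h1 : r < 1) (K : ℕ) (d : ℕ → ℝ) :
    Tendsto (fun n => binomSum (K + 1) d n * r ^ n) atTop (𝓝 0) :=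
  (hasSum_binomSum h0 h1 K d).summable.tendsto_atTop_zero

lemma binomSum_zero (K : ℕ) (d : ℕ → ℝ) : binomSum (K + 1) d 0 = d 0 := by
  rw [binomSum, Finset.sum_range_succ']
  simp [risingChoose_succ_zero, risingChoose_zero]

/-- The coefficients of `(a - ∇)⁻¹ d`, where `∇` is the left shift of coefficients. -/
def shiftResolvent (K : ℕ) (a : ℝ) (d : ℕ → ℝ) (k : ℕ) : ℝ :=
  ∑ u ∈ Finset.Ico k K, d u / a ^ (u + 1 - k)

lemma shiftResolvent_of_le {K k : ℕ} (h : K ≤ k) (a : ℝ) (d : ℕ → ℝ) : shiftResolvent K a d k = 0 := by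
  simp [shiftResolvent, Finset.Ico_eq_empty_of_le h]

lemma shiftResolvent_succ {K : ℕ} {a : ℝ} (ha : a ≠ 0) {d : ℕ → ℝ} (hd : ∀ k, K ≤ k → d k = 0)
    (k : ℕ) : shiftResolvent K a d (k + 1) = a * shiftResolvent K a d k - d k := by
  rcases lt_or_ge k K with h | h
  · rw [shiftResolvent, shiftResolvent, Finset.sum_eq_sum_Ico_succ_bot h, mul_add, Finset.mul_sum]
    have h1 : k + 1 - k = 1 := by omega
    rw [h1, pow_one, mul_div_cancel₀ _ ha, add_sub_cancel_left]
    refine Finset.sum_congr rfl fun u hu => ?_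
    have h2 : u + 1 - k = (u + 1 - (k + 1)) + 1 := by
      have := (Finset.mem_Ico.1 hu).1; omega
    rw [h2, pow_succ]; field_simp
  · rw [shiftResolvent_of_le h, shiftResolvent_of_le (by omega), hd k h]; ring

/-- A coefficientwise identity yields a solution of the second order recurrence of one phase,
with forcing terms coming from the lower phases. -/
lemma binomSum_recurrence {ι : Type*} (s : Finset ι) {K : ℕ} {x : ℕ → ℝ} {c : ι → ℕ → ℝ}
    (A B D : ι → ℝ) {T lam mu r : ℝ} (hr : r ≠ 0) (hx : ∀ k, K ≤ k → x k = 0)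
    (hc : ∀ i ∈ s, ∀ k, K ≤ k → c i k = 0)
    (h : ∀ k, T * (x k - x (k + 1)) - lam / r * (x k - 2 * x (k + 1) + x (k + 2)) - mu * r * x k
      = ∑ i ∈ s, (A i * r * c i k + B i * (c i k - c i (k + 1))
        + D i / r * (c i k - 2 * c i (k + 1) + c i (k + 2)))) (n : ℕ) :
    T * (binomSum K x (n + 1) * r ^ (n + 1))
      = lam * (binomSum K x n * r ^ n) + mu * (binomSum K x (n + 2) * r ^ (n + 2))
        + ∑ i ∈ s, (A i * (binomSum K (c i) (n + 2) * r ^ (n + 2))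
          + B i * (binomSum K (c i) (n + 1) * r ^ (n + 1))
          + D i * (binomSum K (c i) n * r ^ n)) := by
  have e : ∀ i ∈ s, A i * (binomSum K (c i) (n + 2) * r ^ (n + 2))
          + B i * (binomSum K (c i) (n + 1) * r ^ (n + 1)) + D i * (binomSum K (c i) n * r ^ n)
      = ∑ k ∈ Finset.range K, r ^ (n + 1) * risingChoose k (n + 2) *
        (A i * r * c i k + B i * (c i k - c i (k + 1))
          + D i / r * (c i k - 2 * c i (k + 1) + c i (k + 2))) := by
    intro i hi
    rw [binomSum_pred (hc i hi) (n + 1), binomSum_pred_pred (hc i hi) n]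
    simp only [binomSum, Finset.sum_mul, Finset.mul_sum, ← Finset.sum_add_distrib]
    refine Finset.sum_congr rfl fun k _ => ?_
    field_simp
    ring
  rw [Finset.sum_congr rfl e, Finset.sum_comm]
  simp only [← Finset.mul_sum, ← h]
  rw [binomSum_pred hx (n + 1), binomSum_pred_pred hx n]
  simp only [binomSum, Finset.sum_mul, Finset.mul_sum, ← Finset.sum_add_distrib]
  refine Finset.sum_congr rfl fun k _ => ?_
  field_simp
  ring

lemma eq_zero_of_recurrence {d : ℕ → ℝ} {r s : ℝ} (hs : 1 ≤ s)
    (h : ∀ n, d (n + 2) = (r + s) * d (n + 1) - r * s * d n) (h0 : d 0 = 0)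
    (hlim : Tendsto d atTop (𝓝 0)) (n : ℕ) : d n = 0 := by
  -- Factoring out the root r leaves a geometric sequence of ratio s ≥ 1, which can tend to 0 only
  -- if it is zero.
  have he : ∀ n, d (n + 1) - r * d n = s ^ n * d 1 := by
    intro n
    induction n with
    | zero => simp [h0]
    | succ n ih => rw [pow_succ, mul_right_comm, ← ih, h]; ring
  have hl : Tendsto (fun n => d (n + 1) - r * d n) atTop (𝓝 (0 - r * 0)) :=
    (hlim.comp (tendsto_add_atTop_nat 1)).sub (hlim.const_mul r)
  simp only [he, mul_zero, sub_zero] at hl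
  have h1 : d 1 = 0 := by
    have : |d 1| ≤ |0| := ge_of_tendsto hl.abs (Eventually.of_forall fun n => by
      rw [abs_mul]
      exact le_mul_of_one_le_left (abs_nonneg _) ((one_le_pow₀ hs).trans (le_abs_self _)))
    simpa using this
  induction n with
  | zero => exact h0
  | succ n ih => have := he n; rw [h1, ih] at this; simpa using this

/-- `r` and `1 / f` are the roots of `mu x ^ 2 - T x + lam`, and `0 < r < 1 ≤ 1 / f`. -/
structure PhaseRoots (T lam mu r f : ℝ) : Prop where
  lam_pos : 0 < lam
  mu_pos : 0 < mu
  f_pos : 0 < f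
  f_le_one : f ≤ 1
  r_pos : 0 < r
  r_lt_one : r < 1
  r_mul : mu * r = lam * f
  root : lam * f ^ 2 + mu = T * f

namespace PhaseRoots

variable {T lam mu r f : ℝ}

lemma mul_lt_one (h : PhaseRoots T lam mu r f) : r * f < 1 :=
  (mul_le_of_le_one_right h.r_pos.le h.f_le_one).trans_lt h.r_lt_one

lemma mu_eq (h : PhaseRoots T lam mu r f) : mu = lam * f / r := by
  rw [eq_div_iff h.r_pos.ne', h.r_mul]

lemma total_eq (h : PhaseRoots T lam mu r f) : T = lam * f + lam / r := by
  have h1 := h.root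
  have hf := h.f_pos.ne'
  have hr := h.r_pos.ne'
  apply mul_right_cancel₀ hf
  rw [← h1, h.mu_eq]; field_simp

/-- The difference of two solutions solves the homogeneous recurrence with roots r and 1/f ≥ 1,
vanishes at 0 and decays, hence is zero. -/
lemma eq_of_recurrence (h : PhaseRoots T lam mu r f) {a b g : ℕ → ℝ}
    (ha : ∀ n, T * a (n + 1) = lam * a n + mu * a (n + 2) + g n)
    (hb : ∀ n, T * b (n + 1) = lam * b n + mu * b (n + 2) + g n) (h0 : a 0 = b 0)
    (hla : Tendsto a atTop (𝓝 0)) (hlb : Tendsto b atTop (𝓝 0)) (n : ℕ) : a n = b n := by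
  refine sub_eq_zero.1 (eq_zero_of_recurrence (d := fun n => a n - b n) (r := r) (s := 1 / f)
    ((one_le_div h.f_pos).2 h.f_le_one) (fun n => ?_) (by simp [h0])
    (by simpa using hla.sub hlb) n)
  have h1 := ha n
  have h2 := hb n
  apply mul_left_cancel₀ h.mu_pos.ne'
  have h3 : mu * (r + 1 / f) = T := by
    have hf := h.f_pos.ne'
    rw [mul_add, h.r_mul, h.total_eq, h.mu_eq]; field_simp
  have h4 : mu * (r * (1 / f)) = lam := by
    have hf := h.f_pos.ne'
    have hr := h.r_pos.ne'
    rw [h.mu_eq]; field_simp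
  calc mu * (a (n + 2) - b (n + 2)) = T * (a (n + 1) - b (n + 1)) - lam * (a n - b n) := by
        linarith
    _ = _ := by
        linear_combination (-(a (n + 1) - b (n + 1))) * h3 + (a n - b n) * h4

end PhaseRoots

/-- The coefficient produced in a phase with base `r` by a term of a lower phase with the same
base; `A`, `B`, `D` are the rates of the transitions with level change `-1`, `0`, `1`. -/
def sameBaseCoeff (K : ℕ) (lam r f A B D : ℝ) (d : ℕ → ℝ) (k : ℕ) : ℝ :=
  r / (lam * (1 - r * f)) * r * (A + B * f + D * f ^ 2) * shiftResolvent K (1 - r * f) d k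
    + r / (lam * (1 - r * f)) * (A * r + B + D / r) * d (k - 1) - 1 / lam * (D * d k)

/-- The right side is A r + B(1-σ) + (D/r)(1-σ)² applied to d. Dividing by (λ/r) σ ((1-rf) - σ) in
partial fractions gives a resolvent at 1-rf, a right shift and the constant -D/λ: the three terms of
`sameBaseCoeff`. Only indices k ≥ 1 of it occur here, so the truncated `k - 1` at 0 is harmless. -/
lemma PhaseRoots.sameBase_identity {T lam mu r f : ℝ} (h : PhaseRoots T lam mu r f)
    {K : ℕ} {d : ℕ → ℝ} (hd : ∀ k, K ≤ k → d k = 0) (A B D : ℝ) (k : ℕ) :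
    lam / r * ((1 - r * f) * sameBaseCoeff K lam r f A B D d (k + 1)
      - sameBaseCoeff K lam r f A B D d (k + 2))
      = A * r * d k + B * (d k - d (k + 1)) + D / r * (d k - 2 * d (k + 1) + d (k + 2)) := by
  have ha : 1 - r * f ≠ 0 := (sub_pos.2 h.mul_lt_one).ne'
  have hr := h.r_pos.ne'
  have hl := h.lam_pos.ne'
  simp only [sameBaseCoeff, Nat.add_sub_cancel, shiftResolvent_succ ha hd (k + 1),
    show k + 2 - 1 = k + 1 from rfl]
  generalize shiftResolvent K (1 - r * f) d (k + 1) = R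
  field_simp
  ring

/-- The coefficient produced in a phase with base `g ≠ r` and `f = 1` by a term of a lower phase
with base `r`. -/
def newBaseCoeff (K : ℕ) (lam r g A B D : ℝ) (d : ℕ → ℝ) (k : ℕ) : ℝ :=
  -(d k * (D / lam)) + g / (lam * (1 - g)) * r *
    ((A + B + D) * shiftResolvent K (1 - r) d k
      - (A + B / g + D / g ^ 2) * shiftResolvent K (1 - r / g) d k)

/-- With f = 1 the operator on the left is -(λ/r) ((1-r) - σ) ((1-r/g) - σ). Its two simple roots
are nonzero, so there is no resonance: partial fractions give one resolvent for each and the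
constant -D/λ, and the identity determines every index including 0. -/
lemma PhaseRoots.newBase_identity {T lam mu g r : ℝ} (h : PhaseRoots T lam mu g 1)
    (hr : r ≠ 0) (hr1 : r ≠ 1) (hrg : r ≠ g)
    {K : ℕ} {d : ℕ → ℝ} (hd : ∀ k, K ≤ k → d k = 0) (A B D : ℝ) (k : ℕ) :
    T * (newBaseCoeff K lam r g A B D d k - newBaseCoeff K lam r g A B D d (k + 1))
      - lam / r * (newBaseCoeff K lam r g A B D d k - 2 * newBaseCoeff K lam r g A B D d (k + 1)
        + newBaseCoeff K lam r g A B D d (k + 2)) - mu * r * newBaseCoeff K lam r g A B D d k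
      = A * r * d k + B * (d k - d (k + 1)) + D / r * (d k - 2 * d (k + 1) + d (k + 2)) := by
  have hg := h.r_pos.ne'
  have ha : 1 - r ≠ 0 := sub_ne_zero.2 hr1.symm
  have hb : 1 - r / g ≠ 0 := sub_ne_zero.2 fun e => hrg ((div_eq_one_iff_eq hg).1 e.symm)
  have hg1 : 1 - g ≠ 0 := (sub_pos.2 h.r_lt_one).ne'
  have hl := h.lam_pos.ne'
  simp only [newBaseCoeff, shiftResolvent_succ ha hd, shiftResolvent_succ hb hd, h.total_eq, h.mu_eq]
  generalize shiftResolvent K (1 - r) d k = R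
  generalize shiftResolvent K (1 - r / g) d k = R'
  field_simp
  ring

end Sequences

/-! ### Sums over states as sums over phases and levels -/

section Levels

variable {N : Type*} {M j₀ : ℕ}

/-- The state `(m, j₀ + n)` of the repeating portion. -/
abbrev MState.lvl (m : Fin (M + 1)) (n : ℕ) : MState N M j₀ :=
  MState.rep m (j₀ + n) (Nat.le_add_right j₀ n)

lemma MState.rep_eq_lvl (m : Fin (M + 1)) (j : ℕ) (hj : j₀ ≤ j) :
    (MState.rep m j hj : MState N M j₀) = MState.lvl m (j - j₀) := by
  simp only [MState.lvl, MState.rep]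
  congr 3
  omega

/-- Levels are indexed by their distance from `j₀`. -/
def levelEquiv (j₀ : ℕ) : ℕ ≃ {j : ℕ // j₀ ≤ j} where
  toFun n := ⟨j₀ + n, Nat.le_add_right j₀ n⟩
  invFun j := j - j₀
  left_inv n := by simp
  right_inv j := Subtype.ext (by have := j.2; simp; omega)

variable {f : MState N M j₀ → ℝ}

lemma summable_lvl (hf : Summable f) :
    Summable (fun p : Fin (M + 1) × ℕ => f (MState.lvl p.1 p.2)) :=
  hf.comp_injective (i := fun p : Fin (M + 1) × ℕ => MState.lvl p.1 p.2) fun p p' h => by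
    have h1 := Prod.ext_iff.1 (Sum.inr_injective h)
    refine Prod.ext h1.1 ?_
    have := congrArg Subtype.val h1.2
    simpa using this

variable [Fintype N]

lemma tsum_mstate (hf : Summable f) :
    ∑' z, f z = ∑ x, f (MState.non x) + ∑ i, ∑' n, f (MState.lvl i n) := by
  have h1 := hf.comp_injective (i := Sum.inl) Sum.inl_injective
  have h2 := hf.comp_injective (i := Sum.inr) Sum.inr_injective
  rw [h1.tsum_sum h2, tsum_fintype]
  congr 1
  rw [← ((Equiv.refl (Fin (M + 1))).prodCongr (levelEquiv j₀)).tsum_eq]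
  exact (summable_lvl hf).tsum_prod.trans (tsum_fintype _)

lemma summable_of_level_bound {K : ℕ} (h : ∀ i n, K ≤ n → f (MState.lvl i n) = 0) :
    Summable f := by
  refine Summable.sum f Summable.of_finite ?_
  rw [← ((Equiv.refl (Fin (M + 1))).prodCongr (levelEquiv j₀)).summable_iff]
  refine summable_of_ne_finset_zero (s := Finset.univ ×ˢ Finset.range K) fun p hp => ?_
  refine h p.1 p.2 ?_
  by_contra! hlt
  exact hp (by simp [hlt])

lemma tsum_near_succ (l : ℕ) (hN : ∀ x, f (MState.non x) = 0)
    (h : ∀ i n, n + 1 < l + 1 ∨ l + 2 < n → f (MState.lvl i n) = 0) :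
    ∑' z, f z
      = ∑ i, (f (MState.lvl i l) + f (MState.lvl i (l + 1)) + f (MState.lvl i (l + 2))) := by
  rw [tsum_mstate (summable_of_level_bound (K := l + 3) fun i n hn => h i n (by omega))]
  simp only [hN, Finset.sum_const_zero, zero_add]
  refine Finset.sum_congr rfl fun i _ => ?_
  rw [tsum_eq_sum (s := {l, l + 1, l + 2}) fun n hn => h i n (by
    simp only [Finset.mem_insert, Finset.mem_singleton] at hn; omega)]
  rw [Finset.sum_insert (by simp), Finset.sum_pair (by simp)]
  ring

lemma tsum_near_zero (h : ∀ i n, 1 < n → f (MState.lvl i n) = 0) :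
    ∑' z, f z = ∑ x, f (MState.non x) + ∑ i, (f (MState.lvl i 0) + f (MState.lvl i 1)) := by
  rw [tsum_mstate (summable_of_level_bound (K := 2) fun i n hn => h i n (by omega))]
  congr 1
  refine Finset.sum_congr rfl fun i _ => ?_
  rw [tsum_eq_sum (s := {0, 1}) fun n hn => h i n (by
    simp only [Finset.mem_insert, Finset.mem_singleton] at hn; omega)]
  rw [Finset.sum_pair (by simp)]

end Levels

section PhaseSums

variable {M : ℕ}

lemma sum_phases_of_lower_zero (m : Fin (M + 1)) {F : Fin (M + 1) → ℝ} (G : ℕ → ℝ)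
    (h0 : ∀ i, i < m → F i = 0) (hG : ∀ i, m < i → F i = G i) :
    ∑ i, F i = F m + ∑ i ∈ Finset.Icc ((m : ℕ) + 1) M, G i := by
  have h1 : ∑ i, F i = ∑ i ∈ Finset.Ici m, F i :=
    (Finset.sum_subset (Finset.subset_univ _) fun i _ hi => h0 i (by simpa using hi)).symm
  have h2 : Finset.Icc ((m : ℕ) + 1) M = (Finset.Ioi m).map Fin.valEmbedding := by
    rw [Fin.map_valEmbedding_Ioi]; ext; simp only [Finset.mem_Icc, Finset.mem_Ioo]; omega
  rw [h1, ← Finset.Ioi_insert, Finset.sum_insert (by simp), h2, Finset.sum_map]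
  congr 1
  exact Finset.sum_congr rfl fun i hi => hG i (by simpa using hi)

lemma sum_phases_of_upper_zero (m : Fin (M + 1)) {F : Fin (M + 1) → ℝ}
    (h0 : ∀ i, m < i → F i = 0) :
    ∑ i, F i = F m + ∑ i ∈ Finset.Iio m, F i := by
  have h1 : ∑ i, F i = ∑ i ∈ Finset.Iic m, F i :=
    (Finset.sum_subset (Finset.subset_univ _) fun i _ hi => h0 i (by simpa using hi)).symm
  rw [h1, ← Finset.Iio_insert, Finset.sum_insert (by simp)]

lemma sum_Iio_fin (m : Fin (M + 1)) (G : ℕ → ℝ) :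
    ∑ i ∈ Finset.Iio m, G i = ∑ i ∈ Finset.range m, G i := by
  have h2 : Finset.range (m : ℕ) = (Finset.Iio m).map Fin.valEmbedding := by
    rw [Fin.map_valEmbedding_Iio]; ext; simp
  rw [h2, Finset.sum_map]; rfl

lemma sum_int_Icc_neg_one_one (g : ℤ → ℝ) :
    ∑ Δ ∈ Finset.Icc (-1 : ℤ) 1, g Δ = g (-1) + g 0 + g 1 := by
  rw [show Finset.Icc (-1 : ℤ) 1 = {-1, 0, 1} from rfl]
  rw [Finset.sum_insert (by simp), Finset.sum_pair (by simp)]; ring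

lemma sum_int_Icc_zero_one (g : ℤ → ℝ) : ∑ Δ ∈ Finset.Icc (0 : ℤ) 1, g Δ = g 0 + g 1 := by
  rw [show Finset.Icc (0 : ℤ) 1 = {0, 1} from rfl, Finset.sum_pair (by simp)]

end PhaseSums

/-! ### Balance equations of a class 𝕄 chain -/

namespace ClassM

variable {N : Type*} {M j₀ : ℕ} (C : ClassM N M j₀)

lemma alp_nonneg {m i : ℕ} (hmi : m < i) (hi : i ≤ M) {Δ : ℤ} (hΔ : Δ ∈ Finset.Icc (-1 : ℤ) 1) :
    0 ≤ C.alp m (i - m) Δ := by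
  have h : (⟨m, by omega⟩ : Fin (M + 1)) < ⟨i, by omega⟩ := hmi
  have h1 := C.q_up_left _ _ h j₀ le_rfl
  have h2 := C.q_up_stay _ _ h j₀ le_rfl
  have h3 := C.q_up_right _ _ h j₀ le_rfl
  rw [show Finset.Icc (-1 : ℤ) 1 = {-1, 0, 1} from rfl] at hΔ
  simp only [Finset.mem_insert, Finset.mem_singleton] at hΔ
  rcases hΔ with rfl | rfl | rfl
  · exact h1 ▸ C.q_nonneg _ _
  · exact h2 ▸ C.q_nonneg _ _
  · exact h3 ▸ C.q_nonneg _ _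

lemma alpha_nonneg {m : ℕ} : 0 ≤ C.alpha m :=
  Finset.sum_nonneg fun i hi => Finset.sum_nonneg fun Δ hΔ => by
    rw [Finset.mem_Icc] at hi
    exact C.alp_nonneg (by omega) hi.2 hΔ

lemma alpha_last : C.alpha M = 0 := by simp [alpha]

lemma q_lvl_same_far (m : Fin (M + 1)) {n l : ℕ} (h : n = l ∨ n + 1 < l ∨ l + 1 < n) :
    C.q (MState.lvl m n) (MState.lvl m l) = 0 := by
  rcases h with rfl | h
  · exact C.q_self _
  · exact C.q_skip_free _ _ _ _ _ _ (by omega)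

section LevelProb

variable {C} {π : MState N M j₀ → ℝ} {P : ℝ → MState N M j₀ → MState N M j₀ → ℝ}

/-- The probability of the state `(m, j₀ + n)`. -/
noncomputable def levelProb (π : MState N M j₀ → ℝ) (m n : ℕ) : ℝ :=
  if h : m < M + 1 then π (MState.lvl ⟨m, h⟩ n) else 0

lemma levelProb_fin (π : MState N M j₀ → ℝ) (m : Fin (M + 1)) (n : ℕ) : levelProb π m n = π (MState.lvl m n) := by
  rw [levelProb, dif_pos m.2]

lemma summable_levelProb (hπ : IsLimitingDistribution P π) {m : ℕ} (hm : m ≤ M) :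
    Summable (levelProb π m) := by
  obtain ⟨m, rfl⟩ : ∃ m' : Fin (M + 1), (m' : ℕ) = m := ⟨⟨m, by omega⟩, rfl⟩
  exact ((summable_lvl hπ.hasSum_one.summable).prod_factor m).congr fun n =>
    (levelProb_fin π m n).symm

lemma levelProb_pos (hP : IsTransitionFunction C.q P) (herg : IsErgodicChain P)
    (hπ : IsLimitingDistribution P π) {m : ℕ} (hm : m ≤ M) (n : ℕ) : 0 < levelProb π m n := by
  obtain ⟨m, rfl⟩ : ∃ m' : Fin (M + 1), (m' : ℕ) = m := ⟨⟨m, by omega⟩, rfl⟩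
  rw [levelProb_fin]
  exact hπ.pos hP herg _

end LevelProb

variable [Fintype N]

lemma tsum_out_succ (m : Fin (M + 1)) (l : ℕ) :
    ∑' z, C.q (MState.lvl m (l + 1)) z = C.lam m + C.mu m + C.alpha m := by
  rw [tsum_near_succ l (fun x => C.q_rep_non x m _ _ (by omega))
    (fun i n h => C.q_skip_free _ _ _ _ _ _ (by omega))]
  rw [sum_phases_of_lower_zero m (fun i => ∑ Δ ∈ Finset.Icc (-1 : ℤ) 1, C.alp m (i - m) Δ)
    (fun i hi => by simp [C.q_unidirectional m i hi]) (fun i hi => ?_)]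
  · rw [C.q_lvl_same_far m (n := l + 1) (l := l + 1) (by omega)]
    have h1 := C.q_left m (j₀ + l) (by omega)
    have h2 := C.q_right m (j₀ + (l + 1)) (by omega)
    rw [alpha, ← h1, ← h2]
    simp only [MState.lvl, ← add_assoc]
    ring
  · rw [sum_int_Icc_neg_one_one, ← C.q_up_left m i hi (j₀ + l) (by omega),
      ← C.q_up_stay m i hi (j₀ + (l + 1)) (by omega),
      ← C.q_up_right m i hi (j₀ + (l + 1)) (by omega)]
    rfl

lemma tsum_out_zero (m : Fin (M + 1)) :
    ∑' z, C.q (MState.lvl m 0) z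
      = C.lam m + (∑ i ∈ Finset.Icc ((m : ℕ) + 1) M,
          ∑ Δ ∈ Finset.Icc (0 : ℤ) 1, C.alp m (i - m) Δ)
        + ∑ x : N, C.q (MState.rep m j₀ le_rfl) (MState.non x) := by
  rw [tsum_near_zero (fun i n h => C.q_skip_free _ _ _ _ _ _ (by omega))]
  rw [sum_phases_of_lower_zero m (fun i => ∑ Δ ∈ Finset.Icc (0 : ℤ) 1, C.alp m (i - m) Δ)
    (fun i hi => by simp [C.q_unidirectional m i hi]) (fun i hi => ?_)]
  · rw [C.q_lvl_same_far m (n := 0) (l := 0) (by omega), ← C.q_right m j₀ le_rfl]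
    simp only [MState.lvl, add_zero]
    ring
  · rw [sum_int_Icc_zero_one, ← C.q_up_stay m i hi j₀ le_rfl, ← C.q_up_right m i hi j₀ le_rfl]
    rfl

lemma tsum_out_non (x : N) :
    ∑' z, C.q (MState.non x) z
      = (∑ m : Fin (M + 1), C.q (MState.non x) (MState.rep m j₀ le_rfl))
        + ∑ y : N, C.q (MState.non x) (MState.non y) := by
  rw [tsum_near_zero (fun i n h => C.q_non_rep _ _ _ _ (by omega)), add_comm]
  congr 1
  refine Finset.sum_congr rfl fun i _ => ?_
  rw [C.q_non_rep x i (j₀ + 1) _ (by omega), add_zero]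
  rfl

/-- Above level j₀ the exit rate does not depend on the level, so finitely many values occur. -/
lemma exists_exit_rate_le : ∃ K, ∀ x, ∑' y, C.q x y ≤ K := by
  obtain ⟨K₁, h1⟩ := (Set.finite_range
    fun x : N => ∑' y, C.q (MState.non x) y).bddAbove
  obtain ⟨K₂, h2⟩ := (Set.finite_range
    fun m : Fin (M + 1) => ∑' y, C.q (MState.lvl m 0) y).bddAbove
  obtain ⟨K₃, h3⟩ := (Set.finite_range
    fun m : Fin (M + 1) => C.lam m + C.mu m + C.alpha m).bddAbove
  refine ⟨max K₁ (max K₂ K₃), ?_⟩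
  rintro (x | ⟨m, j, hj⟩)
  · exact (h1 ⟨x, rfl⟩).trans (le_max_left _ _)
  · have e := MState.rep_eq_lvl (N := N) m j hj
    rw [MState.rep] at e
    rw [e]
    cases j - j₀ with
    | zero => exact (h2 ⟨m, rfl⟩).trans ((le_max_left _ _).trans (le_max_right _ _))
    | succ l =>
      rw [C.tsum_out_succ]
      exact (h3 ⟨m, rfl⟩).trans ((le_max_right _ _).trans (le_max_right _ _))

variable (π : MState N M j₀ → ℝ)

lemma tsum_in_succ (m : Fin (M + 1)) (l : ℕ) :
    ∑' z, π z * C.q z (MState.lvl m (l + 1))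
      = C.lam m * π (MState.lvl m l) + C.mu m * π (MState.lvl m (l + 2))
        + ∑ i ∈ Finset.Iio m, (C.alp i (m - i) (-1) * π (MState.lvl i (l + 2))
          + C.alp i (m - i) 0 * π (MState.lvl i (l + 1))
          + C.alp i (m - i) 1 * π (MState.lvl i l)) := by
  rw [tsum_near_succ l (fun x => by rw [C.q_non_rep x m _ _ (by omega), mul_zero])
    (fun i n h => by rw [C.q_skip_free _ _ _ _ _ _ (by omega), mul_zero])]
  rw [sum_phases_of_upper_zero m (fun i hi => by simp [C.q_unidirectional i m hi])]
  congr 1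
  · rw [C.q_lvl_same_far m (n := l + 1) (l := l + 1) (by omega)]
    have h1 := C.q_left m (j₀ + (l + 1)) (by omega)
    have h2 := C.q_right m (j₀ + l) (by omega)
    rw [← h1, ← h2]
    simp only [MState.lvl, ← add_assoc]
    ring
  · refine Finset.sum_congr rfl fun i hi => ?_
    have hi := Finset.mem_Iio.1 hi
    rw [← C.q_up_left i m hi (j₀ + (l + 1)) (by omega),
      ← C.q_up_stay i m hi (j₀ + (l + 1)) (by omega),
      ← C.q_up_right i m hi (j₀ + l) (by omega)]
    simp only [MState.lvl, ← add_assoc]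
    ring

lemma tsum_in_zero (m : Fin (M + 1)) :
    ∑' z, π z * C.q z (MState.lvl m 0)
      = C.mu m * π (MState.lvl m 1)
        + (∑ x : N, C.q (MState.non x) (MState.rep m j₀ le_rfl) * π (MState.non x))
        + ∑ i ∈ Finset.Iio m, (C.alp i (m - i) 0 * π (MState.lvl i 0)
          + C.alp i (m - i) (-1) * π (MState.lvl i 1)) := by
  rw [tsum_near_zero (fun i n h => by rw [C.q_skip_free _ _ _ _ _ _ (by omega), mul_zero])]
  rw [sum_phases_of_upper_zero m (fun i hi => by simp [C.q_unidirectional i m hi]),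
    ← add_assoc]
  congr 1
  · rw [C.q_lvl_same_far m (n := 0) (l := 0) (by omega), ← C.q_left m j₀ le_rfl]
    simp only [MState.lvl, add_zero, mul_zero, zero_add]
    rw [add_comm]
    simp only [mul_comm]
  · refine Finset.sum_congr rfl fun i hi => ?_
    have hi := Finset.mem_Iio.1 hi
    rw [← C.q_up_left i m hi j₀ le_rfl, ← C.q_up_stay i m hi j₀ le_rfl]
    simp only [MState.lvl, add_zero]
    ring

lemma tsum_in_non (x : N) :
    ∑' z, π z * C.q z (MState.non x)
      = (∑ m : Fin (M + 1), C.q (MState.rep m j₀ le_rfl) (MState.non x)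
          * π (MState.rep m j₀ le_rfl))
        + ∑ y : N, C.q (MState.non y) (MState.non x) * π (MState.non y) := by
  rw [tsum_near_zero (fun i n h => by rw [C.q_rep_non _ _ _ _ (by omega), mul_zero]), add_comm]
  congr 1
  · refine Finset.sum_congr rfl fun i _ => ?_
    rw [C.q_rep_non x i (j₀ + 1) _ (by omega), mul_zero, add_zero, mul_comm]
    rfl
  · exact Finset.sum_congr rfl fun y _ => mul_comm _ _

section Ergodic

variable {C π} {P : ℝ → MState N M j₀ → MState N M j₀ → ℝ}

lemma balance (hP : IsTransitionFunction C.q P) (hπ : IsLimitingDistribution P π)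
    (y : MState N M j₀) : ∑' z, π z * C.q z y = π y * ∑' z, C.q y z := by
  obtain ⟨K, hK⟩ := C.exists_exit_rate_le
  exact hπ.balance hP C.q_nonneg C.q_self hK y

lemma levelProb_balance (hP : IsTransitionFunction C.q P) (hπ : IsLimitingDistribution P π)
    {m : ℕ} (hm : m ≤ M) (n : ℕ) :
    (C.lam m + C.mu m + C.alpha m) * levelProb π m (n + 1)
      = C.lam m * levelProb π m n + C.mu m * levelProb π m (n + 2)
        + ∑ i ∈ Finset.range m, (C.alp i (m - i) (-1) * levelProb π i (n + 2)
          + C.alp i (m - i) 0 * levelProb π i (n + 1)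
          + C.alp i (m - i) 1 * levelProb π i n) := by
  obtain ⟨m, rfl⟩ : ∃ m' : Fin (M + 1), (m' : ℕ) = m := ⟨⟨m, by omega⟩, rfl⟩
  rw [← sum_Iio_fin]
  simp only [levelProb_fin]
  rw [← C.tsum_in_succ, balance hP hπ, C.tsum_out_succ, mul_comm]

/-- A phase that is not left from levels above `j₀` is positive recurrent. -/
lemma lam_lt_mu (hP : IsTransitionFunction C.q P) (herg : IsErgodicChain P)
    (hπ : IsLimitingDistribution P π) {m : ℕ} (hm : m ≤ M) (hlam : 0 < C.lam m)
    (hα : C.alpha m = 0) : C.lam m < C.mu m := by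
  by_contra! hle
  set a := levelProb π m with ha
  have hpos : ∀ n, 0 < a n := levelProb_pos hP herg hπ hm
  have hlim : Tendsto a atTop (𝓝 0) := (summable_levelProb hπ hm).tendsto_atTop_zero
  -- Since α_m = 0 and the inflow from lower phases is nonnegative, the net upward flux across
  -- successive levels is nondecreasing. Its limit is 0, so it is never positive; with μ_m ≤ λ_m the
  -- positive sequence a would then be nondecreasing and could not decay.
  have hmono : Monotone fun n => C.lam m * a n - C.mu m * a (n + 1) := by
    refine monotone_nat_of_le_succ fun n => ?_
    have hb := levelProb_balance hP hπ hm n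
    have hf : 0 ≤ ∑ i ∈ Finset.range m, (C.alp i (m - i) (-1) * levelProb π i (n + 2)
          + C.alp i (m - i) 0 * levelProb π i (n + 1)
          + C.alp i (m - i) 1 * levelProb π i n) := by
      refine Finset.sum_nonneg fun i hi => ?_
      have hi := Finset.mem_range.1 hi
      have h1 := C.alp_nonneg hi hm (Δ := -1) (by simp)
      have h2 := C.alp_nonneg hi hm (Δ := 0) (by simp)
      have h3 := C.alp_nonneg hi hm (Δ := 1) (by simp)
      have hp := fun n => (levelProb_pos hP herg hπ (hi.le.trans hm) n).le
      have := hp n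
      have := hp (n + 1)
      have := hp (n + 2)
      positivity
    rw [hα] at hb
    simp only [← ha] at hb
    linarith
  have hl : Tendsto (fun n => C.lam m * a n - C.mu m * a (n + 1)) atTop
      (𝓝 (C.lam m * 0 - C.mu m * 0)) :=
    (hlim.const_mul _).sub ((hlim.comp (tendsto_add_atTop_nat 1)).const_mul _)
  rw [mul_zero, mul_zero, sub_zero] at hl
  have hle0 : ∀ n, C.lam m * a n ≤ C.mu m * a (n + 1) := fun n => by
    have := hmono.ge_of_tendsto hl n
    linarith
  have hstep : Monotone a := monotone_nat_of_le_succ fun n => by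
    have := (hle0 n).trans (mul_le_mul_of_nonneg_right hle (hpos (n + 1)).le)
    exact le_of_mul_le_mul_left this hlam
  exact (hpos 0).not_ge (hstep.ge_of_tendsto hlim 0)

end Ergodic

end ClassM

/-! ### Roots of the characteristic polynomial of a phase -/

/-- The busy period transform yields the roots of the characteristic polynomial of a phase. -/
lemma phaseRoots_of_formula {s lam mu f : ℝ} (hlam : 0 < lam) (hmu : 0 < mu) (hs : 0 ≤ s)
    (hlt : s = 0 → lam < mu)
    (hf : f = (s + lam + mu - √((s + lam + mu) ^ 2 - 4 * lam * mu)) / (2 * lam)) :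
    PhaseRoots (lam + mu + s) lam mu (lam / mu * f) f := by
  set T := s + lam + mu with hT
  have hD : 0 ≤ T ^ 2 - 4 * lam * mu := by
    have : T ^ 2 - 4 * lam * mu = (lam - mu) ^ 2 + s * (s + 2 * lam + 2 * mu) := by rw [hT]; ring
    rw [this]; positivity
  set D := √(T ^ 2 - 4 * lam * mu) with hDdef
  have hsq : D ^ 2 = T ^ 2 - 4 * lam * mu := Real.sq_sqrt hD
  have hD0 : 0 ≤ D := Real.sqrt_nonneg _
  have hT0 : 0 < T := by positivity
  have h2 : 2 * lam * f = T - D := by rw [hf]; field_simp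
  have hDT : D < T := by
    refine lt_of_pow_lt_pow_left₀ 2 hT0.le ?_
    have := mul_pos hlam hmu
    rw [hsq]; linarith
  have hfpos : 0 < f := by rw [hf]; exact div_pos (by linarith) (by positivity)
  refine ⟨hlam, hmu, hfpos, ?_, by positivity, ?_, by field_simp, ?_⟩
  · have : |T - 2 * lam| ≤ D := Real.abs_le_sqrt (by nlinarith)
    have := (le_abs_self _).trans this
    have : lam * f ≤ lam * 1 := by linarith
    exact le_of_mul_le_mul_left this hlam
  · rw [div_mul_eq_mul_div, div_lt_one hmu]
    suffices T - 2 * mu < D by linarith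
    -- At s = 0 the discriminant is (λ - μ)², and r < 1 rests on λ < μ. For s > 0, comparing squares
    -- reduces the claim to λ + μ < T.
    rcases hs.eq_or_lt with h | h
    · have := hlt h.symm
      linarith
    · refine lt_of_le_of_lt (le_abs_self _) (lt_of_pow_lt_pow_left₀ 2 hD0 ?_)
      rw [sq_abs, hsq]
      nlinarith
  · have h3 : D = T - 2 * lam * f := by linarith
    rw [h3] at hsq
    have : (4 * lam) * (lam * f ^ 2 + mu) = (4 * lam) * ((lam + mu + s) * f) := by
      rw [show lam + mu + s = T by rw [hT]; ring]
      linear_combination hsq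
    exact mul_left_cancel₀ (by positivity) this

lemma ClassM.phaseRoots {N : Type*} [Fintype N] {M j₀ : ℕ} {C : ClassM N M j₀}
    {P : ℝ → MState N M j₀ → MState N M j₀ → ℝ} {π : MState N M j₀ → ℝ}
    (hP : IsTransitionFunction C.q P) (herg : IsErgodicChain P)
    (hπ : IsLimitingDistribution P π) {m : ℕ} (hm : m ≤ M) (hlam : 0 < C.lam m)
    (hmu : 0 < C.mu m) :
    PhaseRoots (C.lam m + C.mu m + C.alpha m) (C.lam m) (C.mu m) (C.r m)
      (C.phi m (C.alpha m)) := by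
  rw [ClassM.r, if_pos hmu, ClassM.rho]
  exact phaseRoots_of_formula hlam hmu C.alpha_nonneg (ClassM.lam_lt_mu hP herg hπ hm hlam) rfl

lemma ClassM.phi_last {N : Type*} {M j₀ : ℕ} {C : ClassM N M j₀} (hlam : 0 < C.lam M)
    (hlt : C.lam M < C.mu M) : C.phi M (C.alpha M) = 1 := by
  have h : (C.alpha M + C.lam M + C.mu M) ^ 2 - 4 * C.lam M * C.mu M = (C.mu M - C.lam M) ^ 2 := by
    rw [C.alpha_last]; ring
  rw [ClassM.phi, h, Real.sqrt_sq (by linarith), C.alpha_last]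
  field_simp
  ring

/-! ### Recursive construction of the coefficients -/

lemma binomSum_of_support {K L : ℕ} (hKL : K ≤ L) {d : ℕ → ℝ} (hd : ∀ k, K ≤ k → d k = 0)
    (n : ℕ) : binomSum L d n = binomSum K d n :=
  (Finset.sum_subset (Finset.range_subset_range.2 hKL) fun k _ hk => by
    rw [hd k (by simpa using hk), zero_mul]).symm

lemma sum_Ico_eq_sum_range {u m : ℕ} {F : ℕ → ℝ} (h : ∀ i, i < u → F i = 0) :
    ∑ i ∈ Finset.Ico u m, F i = ∑ i ∈ Finset.range m, F i :=
  Finset.sum_subset (fun i hi => Finset.mem_range.2 (Finset.mem_Ico.1 hi).2) fun i hi hn =>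
    h i (by simp only [Finset.mem_range, Finset.mem_Ico] at hi hn; omega)

lemma sum_triangle {k m : ℕ} {F : ℕ → ℕ → ℝ} (h : ∀ i u, i < u → F i u = 0) :
    ∑ u ∈ Finset.Ico k m, ∑ i ∈ Finset.Ico u m, F i u
      = ∑ i ∈ Finset.range m, ∑ u ∈ Finset.Ico k m, F i u := by
  rw [Finset.sum_comm]
  exact Finset.sum_congr rfl fun u _ => sum_Ico_eq_sum_range fun i hi => h i u hi

namespace ClassM

noncomputable section Coefficients

variable {N : Type*} {M j₀ : ℕ} (C : ClassM N M j₀) (p : ℕ → ℝ)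

/-- The coefficient of index `k` in a phase `m < M`, from the coefficients of lower phases. -/
def midSum (c : ℕ → ℕ → ℝ) (m k : ℕ) : ℝ :=
  ∑ i ∈ Finset.range m, sameBaseCoeff m (C.lam m) (C.r 0) (C.phi m (C.alpha m))
    (C.alp i (m - i) (-1)) (C.alp i (m - i) 0) (C.alp i (m - i) 1) (c i) k

/-- The coefficient of index `k < M` in the phase `M`, from the coefficients of lower phases. -/
def lastSum (c : ℕ → ℕ → ℝ) (k : ℕ) : ℝ :=
  ∑ i ∈ Finset.range M, newBaseCoeff M (C.lam M) (C.r 0) (C.r M)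
    (C.alp i (M - i) (-1)) (C.alp i (M - i) 0) (C.alp i (M - i) 1) (c i) k

/-- The coefficients of the phase `m`, from those of the lower phases. -/
def coeffStep (m : ℕ) (c : ℕ → ℕ → ℝ) (k : ℕ) : ℝ :=
  if m < M then (if k = 0 then p m else C.midSum c m k)
  else if k < M then C.lastSum c k else p M - C.lastSum c 0

/-- The coefficients `c_{m,k}` determined by the values `p m` at level `j₀`. -/
def coeff (m : ℕ) : ℕ → ℝ :=
  C.coeffStep p m (fun i => if _h : i < m then coeff i else 0)
termination_by m

lemma coeff_eq (m : ℕ) : C.coeff p m = C.coeffStep p m (C.coeff p) := by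
  rw [coeff]
  funext k
  have hmid : C.midSum (fun i => if _h : i < m then C.coeff p i else 0) m k
      = C.midSum (C.coeff p) m k :=
    Finset.sum_congr rfl fun i hi => by simp only [dif_pos (Finset.mem_range.1 hi)]
  rw [coeffStep, coeffStep, hmid]
  split_ifs with h1 h2 h3
  · rfl
  · rfl
  all_goals
    have hlast : ∀ k, C.lastSum (fun i => if _h : i < m then C.coeff p i else 0) k
        = C.lastSum (C.coeff p) k := fun k =>
      Finset.sum_congr rfl fun i hi => by
        simp only [dif_pos ((Finset.mem_range.1 hi).trans_le (not_lt.1 h1))]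
    simp only [hlast]

variable {C p}

lemma coeff_zero {m : ℕ} (hm : m < M) : C.coeff p m 0 = p m := by
  rw [coeff_eq, coeffStep, if_pos hm, if_pos rfl]

lemma coeff_pos_index {m k : ℕ} (hm : m < M) (hk : 1 ≤ k) :
    C.coeff p m k = C.midSum (C.coeff p) m k := by
  rw [coeff_eq, coeffStep, if_pos hm, if_neg (by omega)]

lemma coeff_last {k : ℕ} (hk : k < M) : C.coeff p M k = C.lastSum (C.coeff p) k := by
  rw [coeff_eq, coeffStep, if_neg (lt_irrefl M), if_pos hk]

lemma coeff_last_diag : C.coeff p M M = p M - C.lastSum (C.coeff p) 0 := by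
  rw [coeff_eq, coeffStep, if_neg (lt_irrefl M), if_neg (lt_irrefl M)]

/-- Only the right-shift term of `sameBaseCoeff` reaches beyond the support of a lower phase, and it
does so by one index; hence degree at most m in phase m. -/
lemma coeff_of_lt {m : ℕ} (hm : m < M) {k : ℕ} (hk : m < k) : C.coeff p m k = 0 := by
  induction m using Nat.strong_induction_on generalizing k with
  | _ m ih =>
    rw [coeff_pos_index hm (by omega)]
    refine Finset.sum_eq_zero fun i hi => ?_
    have hi := Finset.mem_range.1 hi
    rw [sameBaseCoeff, shiftResolvent_of_le hk.le, ih i hi (hi.trans hm) (by omega),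
      ih i hi (hi.trans hm) (by omega)]
    ring

/-- Lets `lastSum` serve as the binomial part of phase M. `coeff p M` cannot, since its entry at
index M is the coefficient of r_M^n. -/
lemma lastSum_of_le {k : ℕ} (hk : M ≤ k) : C.lastSum (C.coeff p) k = 0 := by
  refine Finset.sum_eq_zero fun i hi => ?_
  have hi := Finset.mem_range.1 hi
  rw [newBaseCoeff, shiftResolvent_of_le hk, shiftResolvent_of_le hk, coeff_of_lt hi (by omega)]
  ring

/-- The recursion sums phase by phase. As c_{i,u} = 0 for i < u, exchanging the sums over the
triangle k ≤ u ≤ i < m gives the stated double sum. -/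
lemma midSum_eq {m k : ℕ} (hm : m < M) (hr : C.r m = C.r 0) :
    C.midSum (C.coeff p) m k =
      C.Omega m * C.r 0 * (∑ u ∈ Finset.Ico k m, ∑ i ∈ Finset.Ico u m, C.coeff p i u *
        ∑ Δ ∈ Finset.Icc (-1 : ℤ) 1, C.alp i (m - i) Δ * C.phi m (C.alpha m) ^ (Δ + 1) /
          (1 - C.r 0 * C.phi m (C.alpha m)) ^ (u + 1 - k))
      + C.Omega m * (∑ i ∈ Finset.Ico (k - 1) m, C.coeff p i (k - 1) *
        ∑ Δ ∈ Finset.Icc (-1 : ℤ) 1, C.alp i (m - i) Δ * C.r 0 ^ (-Δ))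
      - 1 / C.lam m * ∑ i ∈ Finset.Ico k m, C.coeff p i k * C.alp i (m - i) 1 := by
  have h1 : ∀ k, ∀ i ∈ Finset.range m, i < k → C.coeff p i k = 0 := fun k i hi hik =>
    coeff_of_lt ((Finset.mem_range.1 hi).trans hm) hik
  have e1 : ∑ u ∈ Finset.Ico k m, ∑ i ∈ Finset.Ico u m, C.coeff p i u *
        ∑ Δ ∈ Finset.Icc (-1 : ℤ) 1, C.alp i (m - i) Δ * C.phi m (C.alpha m) ^ (Δ + 1) /
          (1 - C.r 0 * C.phi m (C.alpha m)) ^ (u + 1 - k)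
      = ∑ i ∈ Finset.range m, ∑ u ∈ Finset.Ico k m, (if i < u then 0 else C.coeff p i u *
        ∑ Δ ∈ Finset.Icc (-1 : ℤ) 1, C.alp i (m - i) Δ * C.phi m (C.alpha m) ^ (Δ + 1) /
          (1 - C.r 0 * C.phi m (C.alpha m)) ^ (u + 1 - k)) := by
    rw [← sum_triangle fun i u hiu => if_pos hiu]
    refine Finset.sum_congr rfl fun u _ => Finset.sum_congr rfl fun i hi => ?_
    rw [if_neg (not_lt.2 (Finset.mem_Ico.1 hi).1)]
  have e2 : ∀ (k : ℕ) (G : ℕ → ℝ), ∑ i ∈ Finset.Ico k m, C.coeff p i k * G i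
      = ∑ i ∈ Finset.range m, C.coeff p i k * G i := fun k G =>
    Finset.sum_subset (fun i hi => Finset.mem_range.2 (Finset.mem_Ico.1 hi).2) fun i hi hn => by
      rw [h1 k i hi (by simp only [Finset.mem_range, Finset.mem_Ico] at hi hn; omega), zero_mul]
  rw [e1, e2, e2, Finset.mul_sum, Finset.mul_sum, Finset.mul_sum, ← Finset.sum_add_distrib,
    ← Finset.sum_sub_distrib]
  refine Finset.sum_congr rfl fun i hi => ?_
  have e3 : ∑ u ∈ Finset.Ico k m, (if i < u then 0 else C.coeff p i u *
        ∑ Δ ∈ Finset.Icc (-1 : ℤ) 1, C.alp i (m - i) Δ * C.phi m (C.alpha m) ^ (Δ + 1) /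
          (1 - C.r 0 * C.phi m (C.alpha m)) ^ (u + 1 - k))
      = (C.alp i (m - i) (-1) + C.alp i (m - i) 0 * C.phi m (C.alpha m)
          + C.alp i (m - i) 1 * C.phi m (C.alpha m) ^ 2)
        * shiftResolvent m (1 - C.r 0 * C.phi m (C.alpha m)) (C.coeff p i) k := by
    rw [shiftResolvent, Finset.mul_sum]
    refine Finset.sum_congr rfl fun u _ => ?_
    split_ifs with hiu
    · rw [h1 u i hi hiu]; ring
    · rw [sum_int_Icc_neg_one_one]
      norm_num
      ring
  rw [e3, sum_int_Icc_neg_one_one, sameBaseCoeff, Omega, hr]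
  norm_num
  ring

lemma lastSum_eq {k : ℕ} (hφ : C.phi M (C.alpha M) = 1) (hrM : C.r M ≠ 0) :
    C.lastSum (C.coeff p) k =
      - (∑ i ∈ Finset.Ico k M, C.coeff p i k * (C.alp i (M - i) 1 / C.lam M))
      + ∑ u ∈ Finset.Ico k M, ∑ i ∈ Finset.Ico u M, C.coeff p i u * C.Omega M * C.r 0 *
        ∑ Δ ∈ Finset.Icc (-1 : ℤ) 1, C.alp i (M - i) Δ *
          (1 / (1 - C.r 0) ^ (u + 1 - k)
            - 1 / (C.r M ^ (Δ + 1) * (1 - C.r 0 / C.r M) ^ (u + 1 - k))) := by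
  have h1 : ∀ k, ∀ i ∈ Finset.range M, i < k → C.coeff p i k = 0 := fun k i hi hik =>
    coeff_of_lt (Finset.mem_range.1 hi) hik
  have e1 : ∑ u ∈ Finset.Ico k M, ∑ i ∈ Finset.Ico u M, C.coeff p i u * C.Omega M * C.r 0 *
        ∑ Δ ∈ Finset.Icc (-1 : ℤ) 1, C.alp i (M - i) Δ *
          (1 / (1 - C.r 0) ^ (u + 1 - k)
            - 1 / (C.r M ^ (Δ + 1) * (1 - C.r 0 / C.r M) ^ (u + 1 - k)))
      = ∑ i ∈ Finset.range M, ∑ u ∈ Finset.Ico k M, (if i < u then 0 else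
        C.coeff p i u * C.Omega M * C.r 0 *
        ∑ Δ ∈ Finset.Icc (-1 : ℤ) 1, C.alp i (M - i) Δ *
          (1 / (1 - C.r 0) ^ (u + 1 - k)
            - 1 / (C.r M ^ (Δ + 1) * (1 - C.r 0 / C.r M) ^ (u + 1 - k)))) := by
    rw [← sum_triangle fun i u hiu => if_pos hiu]
    refine Finset.sum_congr rfl fun u _ => Finset.sum_congr rfl fun i hi => ?_
    rw [if_neg (not_lt.2 (Finset.mem_Ico.1 hi).1)]
  have e2 : ∑ i ∈ Finset.Ico k M, C.coeff p i k * (C.alp i (M - i) 1 / C.lam M)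
      = ∑ i ∈ Finset.range M, C.coeff p i k * (C.alp i (M - i) 1 / C.lam M) :=
    Finset.sum_subset (fun i hi => Finset.mem_range.2 (Finset.mem_Ico.1 hi).2) fun i hi hn => by
      rw [h1 k i hi (by simp only [Finset.mem_range, Finset.mem_Ico] at hi hn; omega), zero_mul]
  rw [e1, e2, ← Finset.sum_neg_distrib, ← Finset.sum_add_distrib]
  refine Finset.sum_congr rfl fun i hi => ?_
  rw [newBaseCoeff, Omega, hφ, mul_one]
  congr 1
  simp only [shiftResolvent, Finset.mul_sum, ← Finset.sum_sub_distrib]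
  refine Finset.sum_congr rfl fun u _ => ?_
  split_ifs with hiu
  · rw [h1 u i hi hiu]; ring
  · rw [sum_int_Icc_neg_one_one]
    norm_num
    field_simp
    ring

end Coefficients

/-! ### Solving the recurrence in each phase -/

section Solution

variable {N : Type*} [Fintype N] {M j₀ : ℕ} {C : ClassM N M j₀}
  {P : ℝ → MState N M j₀ → MState N M j₀ → ℝ} {π : MState N M j₀ → ℝ}

/-- The solution of the balance equations in the phases with the common base term. -/
lemma levelProb_eq_binomSum (hP : IsTransitionFunction C.q P) (herg : IsErgodicChain P)
    (hπ : IsLimitingDistribution P π)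
    (hlam : ∀ m, m ≤ M → 0 < C.lam m) (hmu : ∀ m, m ≤ M → 0 < C.mu m)
    (hr : ∀ m, m < M → C.r m = C.r 0) {m : ℕ} (hm : m < M) (n : ℕ) :
    levelProb π m n
      = binomSum (M + 1) (C.coeff (fun i => levelProb π i 0) m) n * C.r 0 ^ n := by
  induction m using Nat.strong_induction_on generalizing n with
  | _ m ih =>
    have hroots := ClassM.phaseRoots hP herg hπ hm.le (hlam m hm.le) (hmu m hm.le)
    rw [hr m hm] at hroots
    set c := C.coeff (fun i => levelProb π i 0) with hc
    refine hroots.eq_of_recurrence (levelProb_balance hP hπ hm.le) (fun n => ?_) ?_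
      (summable_levelProb hπ hm.le).tendsto_atTop_zero
      (tendsto_binomSum hroots.r_pos.le hroots.r_lt_one _ _) n
    · refine (binomSum_recurrence (Finset.range m) (K := M + 1) (c := c) (x := c m)
        (lam := C.lam m) (mu := C.mu m) (fun i => C.alp i (m - i) (-1))
        (fun i => C.alp i (m - i) 0) (fun i => C.alp i (m - i) 1) hroots.r_pos.ne'
        (fun k hk => coeff_of_lt hm (by omega)) (fun i hi k hk => ?_) (fun k => ?_) n).trans ?_
      · exact coeff_of_lt ((Finset.mem_range.1 hi).trans hm)
          (by have := Finset.mem_range.1 hi; omega)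
      -- Summed over i, the left side of the identity is the factored operator applied to c m. It
      -- involves only the indices k+1 and k+2, so the free choice of c m 0 does no harm.
      · have hid : ∀ i ∈ Finset.range m, _ := fun i hi =>
          hroots.sameBase_identity (K := m) (d := c i)
            (fun k hk => coeff_of_lt ((Finset.mem_range.1 hi).trans hm)
              ((Finset.mem_range.1 hi).trans_le hk))
            (C.alp i (m - i) (-1)) (C.alp i (m - i) 0) (C.alp i (m - i) 1) k
        rw [← Finset.sum_congr rfl hid, ← Finset.mul_sum, Finset.sum_sub_distrib,
          ← Finset.mul_sum]
        have h1 : c m (k + 1) = C.midSum c m (k + 1) := coeff_pos_index hm (by omega)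
        have h2 : c m (k + 2) = C.midSum c m (k + 2) := coeff_pos_index hm (by omega)
        rw [midSum] at h1 h2
        rw [← h1, ← h2, hroots.total_eq, hroots.mu_eq]
        have := hroots.r_pos.ne'
        field_simp
        ring
      · congr 1
        refine Finset.sum_congr rfl fun i hi => ?_
        have hi := Finset.mem_range.1 hi
        simp only [ih i hi (hi.trans hm)]
    · rw [binomSum_zero, hc, coeff_zero hm, pow_zero, mul_one]

/-- The solution of the balance equations in the last phase. -/
lemma levelProb_last_eq (hP : IsTransitionFunction C.q P) (herg : IsErgodicChain P)
    (hπ : IsLimitingDistribution P π)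
    (hlam : ∀ m, m ≤ M → 0 < C.lam m) (hmu : ∀ m, m ≤ M → 0 < C.mu m)
    (hr : ∀ m, m < M → C.r m = C.r 0) (hM : 0 < M) (hrM : C.r M ≠ C.r 0) (n : ℕ) :
    levelProb π M n
      = binomSum (M + 1) (C.lastSum (C.coeff fun i => levelProb π i 0)) n * C.r 0 ^ n
        + C.coeff (fun i => levelProb π i 0) M M * C.r M ^ n := by
  have hroots₀ := ClassM.phaseRoots hP herg hπ hM.le (hlam 0 hM.le) (hmu 0 hM.le)
  have hroots := ClassM.phaseRoots hP herg hπ le_rfl (hlam M le_rfl) (hmu M le_rfl)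
  rw [phi_last (hlam M le_rfl) (lam_lt_mu hP herg hπ le_rfl (hlam M le_rfl) C.alpha_last)]
    at hroots
  set c := C.coeff (fun i => levelProb π i 0) with hc
  refine hroots.eq_of_recurrence
    (b := fun n => binomSum (M + 1) (C.lastSum c) n * C.r 0 ^ n + c M M * C.r M ^ n)
    (levelProb_balance hP hπ le_rfl) (fun n => ?_) ?_
    (summable_levelProb hπ le_rfl).tendsto_atTop_zero ?_ n
  · have hpoly := binomSum_recurrence (Finset.range M) (K := M + 1) (c := c)
      (x := C.lastSum c) (T := C.lam M + C.mu M + C.alpha M) (lam := C.lam M) (mu := C.mu M)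
      (fun i => C.alp i (M - i) (-1)) (fun i => C.alp i (M - i) 0) (fun i => C.alp i (M - i) 1)
      hroots₀.r_pos.ne' (fun k hk => lastSum_of_le (by omega))
      (fun i hi k hk => coeff_of_lt (Finset.mem_range.1 hi)
        (by have := Finset.mem_range.1 hi; omega)) (fun k => ?_) n
    -- r_M^n solves the homogeneous recurrence, so any multiple of it may be added to the particular
    -- solution with base r_0.
    · have hg : (C.lam M + C.mu M + C.alpha M) * C.r M ^ (n + 1)
          = C.lam M * C.r M ^ n + C.mu M * C.r M ^ (n + 2) := by
        rw [hroots.total_eq, hroots.mu_eq]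
        have := hroots.r_pos.ne'
        field_simp
        ring
      have hf : ∑ i ∈ Finset.range M, (C.alp i (M - i) (-1) * levelProb π i (n + 2)
          + C.alp i (M - i) 0 * levelProb π i (n + 1) + C.alp i (M - i) 1 * levelProb π i n)
          = _ := Finset.sum_congr rfl fun i hi => by
        have hi := Finset.mem_range.1 hi
        simp only [levelProb_eq_binomSum hP herg hπ hlam hmu hr hi]
        rfl
      rw [hf]
      linear_combination hpoly + c M M * hg
    · have hid : ∀ i ∈ Finset.range M, _ := fun i hi =>
        hroots.newBase_identity hroots₀.r_pos.ne' hroots₀.r_lt_one.ne hrM.symm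
          (K := M) (d := c i) (fun k hk => coeff_of_lt (Finset.mem_range.1 hi)
            ((Finset.mem_range.1 hi).trans_le hk))
          (C.alp i (M - i) (-1)) (C.alp i (M - i) 0) (C.alp i (M - i) 1) k
      rw [← Finset.sum_congr rfl hid]
      simp only [lastSum, Finset.sum_sub_distrib, Finset.sum_add_distrib, ← Finset.mul_sum]
  · simp only [binomSum_zero, pow_zero, mul_one]
    rw [hc, coeff_last_diag]
    ring
  · have h1 := tendsto_binomSum hroots₀.r_pos.le hroots₀.r_lt_one M (C.lastSum c)
    have h2 := (tendsto_pow_atTop_nhds_zero_of_lt_one hroots.r_pos.le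
      hroots.r_lt_one).const_mul (c M M)
    simpa using h1.add h2

end Solution

end ClassM

/-! ### Verification of the linear system -/

theorem theorem5 {N : Type*} [Fintype N] (M j₀ : ℕ) (C : ClassM N M j₀)
    (P : ℝ → MState N M j₀ → MState N M j₀ → ℝ) (hP : IsTransitionFunction C.q P)
    (herg : IsErgodicChain P)
    (π : MState N M j₀ → ℝ) (hπ : IsLimitingDistribution P π)
    (hlam : ∀ m, m ≤ M → 0 < C.lam m) (hmu : ∀ m, m ≤ M → 0 < C.mu m)
    (hr : ∀ m, m < M → C.r m = C.r 0) (hrM : C.r M ≠ C.r 0) :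
    ∃ c : ℕ → ℕ → ℝ,
      (∀ (m : Fin (M + 1)) (j : ℕ) (hj : j₀ ≤ j), (m : ℕ) < M →
        π (MState.rep m j hj)
          = ∑ k ∈ Finset.range ((m : ℕ) + 1),
              c m k * (Nat.choose (j - j₀ + k - 1) k : ℝ) * C.r 0 ^ (j - j₀)) ∧
      (∀ (j : ℕ) (hj : j₀ ≤ j),
        π (MState.rep (Fin.last M) j hj)
          = (∑ k ∈ Finset.range M,
              c M k * (Nat.choose (j - j₀ + k - 1) k : ℝ) * C.r 0 ^ (j - j₀))
            + c M M * C.r M ^ (j - j₀)) ∧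
      C.LinearSystem c (fun m => π (MState.rep m j₀ le_rfl)) (fun x => π (MState.non x)) := by
  have hM : 0 < M := Nat.pos_of_ne_zero fun h => hrM (by subst h; rfl)
  have hroots₀ := ClassM.phaseRoots hP herg hπ hM.le (hlam 0 hM.le) (hmu 0 hM.le)
  have hroots := ClassM.phaseRoots hP herg hπ le_rfl (hlam M le_rfl) (hmu M le_rfl)
  have hφ := ClassM.phi_last (hlam M le_rfl)
    (ClassM.lam_lt_mu hP herg hπ le_rfl (hlam M le_rfl) C.alpha_last)
  set c := C.coeff (fun i => ClassM.levelProb π i 0) with hc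
  have hmid : ∀ m, m < M → ∀ n, ClassM.levelProb π m n
      = binomSum (m + 1) (c m) n * C.r 0 ^ n := fun m hm n => by
    rw [ClassM.levelProb_eq_binomSum hP herg hπ hlam hmu hr hm,
      binomSum_of_support (by omega : m + 1 ≤ M + 1) fun k hk =>
        ClassM.coeff_of_lt hm (by omega)]
  have hlast : ∀ n, ClassM.levelProb π M n
      = binomSum M (c M) n * C.r 0 ^ n + c M M * C.r M ^ n := fun n => by
    rw [ClassM.levelProb_last_eq hP herg hπ hlam hmu hr hM hrM,
      binomSum_of_support (Nat.le_succ M) fun k hk => ClassM.lastSum_of_le hk]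
    congr 2
    exact Finset.sum_congr rfl fun k hk => by
      rw [hc, ClassM.coeff_last (Finset.mem_range.1 hk)]
  -- At n = 1 each binomial is binom(k, k) = 1, whence the plain coefficient sums for level j₀ + 1.
  have hone : ∀ K d, binomSum K d 1 = ∑ k ∈ Finset.range K, d k := fun K d =>
    Finset.sum_congr rfl fun k _ => by simp [risingChoose]
  have hmid_one : ∀ m : Fin (M + 1), (m : ℕ) < M → π (MState.lvl m 1)
      = ∑ k ∈ Finset.range ((m : ℕ) + 1), c m k * C.r 0 := fun m hm => by
    rw [← ClassM.levelProb_fin π, hmid m hm, hone, pow_one, Finset.sum_mul]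
  have hlast_one : π (MState.lvl (Fin.last M) 1)
      = (∑ k ∈ Finset.range M, c M k * C.r 0) + c M M * C.r M := by
    rw [← ClassM.levelProb_fin π, Fin.val_last, hlast, hone, pow_one, pow_one, Finset.sum_mul]
  have hIio : ∀ m : Fin (M + 1), ∑ i ∈ Finset.Iio m, (C.alp i ((m : ℕ) - i) 0 * π (MState.lvl i 0)
        + C.alp i ((m : ℕ) - i) (-1) * π (MState.lvl i 1))
      = ∑ i ∈ Finset.Iio m, (C.alp i ((m : ℕ) - i) 0 * π (MState.rep i j₀ le_rfl)
        + C.alp i ((m : ℕ) - i) (-1) * ∑ k ∈ Finset.range ((i : ℕ) + 1), c i k * C.r 0) :=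
    fun m => Finset.sum_congr rfl fun i hi => by
      have him : i < m := Finset.mem_Iio.1 hi
      rw [hmid_one i (by omega)]
      rfl
  have hbal := fun m : Fin (M + 1) => ClassM.balance hP hπ (MState.lvl m 0)
  simp only [C.tsum_in_zero, C.tsum_out_zero, hIio] at hbal
  refine ⟨c, fun m j hj hm => ?_, fun j hj => ?_, ?_, ?_, ?_, ?_, ?_, ?_, ?_, ?_, ?_⟩
  · rw [MState.rep_eq_lvl, ← ClassM.levelProb_fin π, hmid m hm, binomSum, Finset.sum_mul]
    rfl
  · rw [MState.rep_eq_lvl, ← ClassM.levelProb_fin π, Fin.val_last, hlast, binomSum, Finset.sum_mul]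
    rfl
  · intro m hm
    rw [hc, ClassM.coeff_zero hm, ClassM.levelProb_fin]
    rfl
  · intro m k hk _ hm
    rw [hc, ClassM.coeff_pos_index hm hk, ClassM.midSum_eq hm (hr m hm)]
  -- For k = m the ranges starting at m are empty, and only i = m - 1 survives in the right-shift
  -- term.
  · intro m hm1 hm
    rw [hc, ClassM.coeff_pos_index hm hm1, ClassM.midSum_eq hm (hr m hm),
      Finset.Ico_self, Finset.sum_empty, Finset.sum_empty]
    obtain ⟨m, rfl⟩ : ∃ l, m = l + 1 := ⟨m - 1, by omega⟩
    simp only [Nat.add_sub_cancel, Nat.Ico_succ_singleton, Finset.sum_singleton,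
      Nat.add_sub_cancel_left]
    ring
  · intro k hk
    rw [hc, ClassM.coeff_last hk, ClassM.lastSum_eq hφ hroots.r_pos.ne']
  · rw [hc, ClassM.coeff_last_diag, ClassM.coeff_last hM]
    congr 1
    exact ClassM.levelProb_fin π (Fin.last M) 0
  · intro m hm
    rw [← hmid_one m hm]
    exact (hbal m).symm
  · have h : π (MState.rep (Fin.last M) j₀ le_rfl) * _ = _ := (hbal (Fin.last M)).symm
    rw [hlast_one] at h
    simpa using h
  · intro x
    rw [← C.tsum_out_non, ← C.tsum_in_non]
    exact (ClassM.balance hP hπ _).symm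
  -- Total mass one, with the sum over levels of each phase evaluated in closed form.
  · have h := tsum_mstate hπ.hasSum_one.summable
    rw [hπ.hasSum_one.tsum_eq] at h
    simp only [← ClassM.levelProb_fin π] at h
    rw [Fin.sum_univ_eq_sum_range (fun m => ∑' n, ClassM.levelProb π m n),
      Finset.sum_range_succ, ← add_assoc] at h
    refine Eq.trans ?_ h.symm
    congr 1
    · congr 1
      refine Finset.sum_congr rfl fun m hm => ?_
      rw [← (hasSum_binomSum hroots₀.r_pos.le hroots₀.r_lt_one m (c m)).tsum_eq]
      exact tsum_congr fun n => (hmid m (Finset.mem_range.1 hm) n).symm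
    · obtain ⟨L, hL⟩ : ∃ L, M = L + 1 := ⟨M - 1, by omega⟩
      have h1 := (hasSum_binomSum hroots₀.r_pos.le hroots₀.r_lt_one L (c M)).add
        ((hasSum_geometric_of_lt_one hroots.r_pos.le hroots.r_lt_one).mul_left (c M M))
      have hI : Finset.Ico 1 M = Finset.Icc 1 L := by
        ext; simp only [Finset.mem_Ico, Finset.mem_Icc]; omega
      rw [hI, div_eq_mul_inv (c M M), ← h1.tsum_eq, ← hL]
      exact tsum_congr fun n => (hlast n).symm
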